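/- **Setting.** Let $d\ge 1$, let $T$ be the $d$-ary rooted tree, whose vertices are the finite words in the alphabet $\{0,\dots,d-1\}$, and let $L(n)$ be the set of words of length $n$. Let $H\le \mathrm{Sym}(\{0,\dots,d-1\})$ be a transitive permutation group. For $g\in\mathrm{Aut}(T)$ and a vertex $v$ let $\beta(g,v)\in \mathrm{Aut}(T)$ be the automorphism with $g(vw)=g(v)\,\beta(g,v)(w)$ for all words $w$, and let $W(H)$ be the group of all $g\in \mathrm{Aut}(T)$ such that, for every vertex $v$, the permutation of the first level induced by $\beta(g,v)$ belongs to $H$ (the infinite iterated wreath product of $H$). It is a compact group in the topology of pointwise convergence on the vertices; let $\mu$ be its Haar probability measure. For $k\in\mathbf N$ let $F_k$ be the free group of rank $k$, and endow $\mathrm{Hom}(F_k,W(H))\cong W(H)^k$ with the product measure $\mu^k$. For a subgroup $G\le W(H)$ let $G_n$ be the quotient of $G$ by the pointwise stabilizer of $L(n)$ in $G$, and set $W_n=W(H)_n$. The Hausdorff dimension of $G$ is $$\dim_H G=\liminf_{n\to\infty}\frac{\log|G_n|}{\log|W_n|}\qquad(\text{with } 0/0=0).$$ For a vertex $v$, put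 $\beta(G,v)=\{\beta(g,v) : g\in G,\ g(v)=v\}$, a subgroup of $W(H)$. **Statement.** Suppose that for some $K\in\mathbf N$, $\dim_H\overline{\phi(F_K)}>0$ for almost every $\phi\in\mathrm{Hom}(F_K,W(H))$. Let $m\ge 2$. Then for almost every $\phi\in\mathrm{Hom}(F_m,W(H))$, every non-cyclic subgroup $\Delta\le F_m$ satisfies $$\dim_H\phi(\Delta)>0 .$$ More precisely, there are measurable functions $N=N(\Delta,\phi)\in\mathbf N$, a vertex $v=v(\Delta,\phi,Z)$ and elements $\alpha_k=\alpha_k(\Delta,\phi,Z)\in F_m$ for $1\le k\le K$ (defined for each non-cyclic $\Delta\le F_m$ and each set $Z$ of vertices, and measurable in $\phi$) such that the following hold. 1. For every non-cyclic $\Delta\le F_m$, every set $Z$ of vertices and every $n\in\mathbf N$: if the event "$N=n$ and $Z$ is an orbit of $\phi(\Delta)$ on $L(n)$" has positive probability, then, conditionally on this event, $\beta(\phi(\alpha_1),v),\dots,\beta(\phi(\alpha_K),v)$ are $K$ independent Haar-random elements of $W(H)$. 2. For almost every $\phi$, for every non-cyclic $\Delta\le F_m$ and every orbit $Z$ of $\phi(\Delta)$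 on $L(N)$: $v\in Z$; each $\alpha_k$ lies in $\Delta$ and $\phi(\alpha_k)$ fixes $v$; and, with $A=\phi(\langle\alpha_1,\dots,\alpha_K\rangle)$, $$\dim_H\phi(\Delta)\ \ge\ \frac{\dim_H\beta(A,v)}{d^{N}}\ >\ 0 .$$ -/

import Mathlib

namespace IteratedWreath

open MeasureTheory Filter Topology

/-- The vertices of the `d`-ary rooted tree `T`: finite words in the digits `0, …, d - 1`.  The root
is the empty word, the level of a vertex is its length, and `w` is a descendant of `v` if and only
if `v` is a prefix of `w` (written `v <+: w`). -/
abbrev Vertex (d : ℕ) : Type := List (Fin d)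

/-- `Aut(T)`: the permutations of the vertices that preserve levels and the descendant relation.
Automorphisms act from the left, so `(g * h) v = g (h v)`. -/
def treeAut (d : ℕ) : Subgroup (Equiv.Perm (Vertex d)) where
  carrier := {g | (∀ v, (g v).length = v.length) ∧ ∀ v w, g v <+: g w ↔ v <+: w}
  one_mem' := by simp
  mul_mem' := by
    rintro g h ⟨hg, hg'⟩ ⟨hh, hh'⟩
    exact ⟨fun v => by simp [hg, hh], fun v w => by simp [hg', hh']⟩
  inv_mem' := by
    rintro g ⟨hg, hg'⟩
    refine ⟨fun v => ?_, fun v w => ?_⟩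
    · rw [← hg (g⁻¹ v)]; simp
    · rw [← hg' (g⁻¹ v) (g⁻¹ w)]; simp

variable {d : ℕ}

/-- The group `W(H)`: the automorphisms of `T` whose local action at every vertex `v`, that is
the permutation `h` of `0, …, d - 1` with `g (v i) = (g v) (h i)`, belongs to `H`. -/
def W (H : Subgroup (Equiv.Perm (Fin d))) : Subgroup (Equiv.Perm (Vertex d)) where
  carrier := {g | g ∈ treeAut d ∧ ∀ v, ∃ h ∈ H, ∀ i, g (v ++ [i]) = g v ++ [h i]}
  one_mem' := ⟨one_mem _, fun v => ⟨1, one_mem _, fun i => rfl⟩⟩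
  mul_mem' := by
    rintro g g' ⟨hg, hg'⟩ ⟨hh, hh'⟩
    refine ⟨mul_mem hg hh, fun v => ?_⟩
    obtain ⟨a, ha, ha'⟩ := hh' v
    obtain ⟨b, hb, hb'⟩ := hg' (g' v)
    exact ⟨b * a, mul_mem hb ha, fun i => by simp [ha', hb']⟩
  inv_mem' := by
    rintro g ⟨hg, hg'⟩
    refine ⟨inv_mem hg, fun v => ?_⟩
    obtain ⟨a, ha, ha'⟩ := hg' (g⁻¹ v)
    refine ⟨a⁻¹, inv_mem ha, fun i => ?_⟩
    rw [Equiv.Perm.inv_eq_iff_eq, ha']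
    simp

variable {H : Subgroup (Equiv.Perm (Fin d))}

theorem smul_def (g : W H) (v : Vertex d) : g • v = (g : Equiv.Perm (Vertex d)) v := rfl

theorem length_smul (g : W H) (v : Vertex d) : (g • v).length = v.length := g.2.1.1 v

theorem smul_prefix (g : W H) (v w : Vertex d) : g • v <+: g • w ↔ v <+: w := g.2.1.2 v w

/-- For `g ∈ W(H)` and a vertex `v`, the word `x` such that `g (v w) = (g v) x`. -/
def secFun (g : W H) (v w : Vertex d) : Vertex d := (g • (v ++ w)).drop v.length

theorem smul_append (g : W H) (v w : Vertex d) : g • (v ++ w) = g • v ++ secFun g v w := by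
  obtain ⟨x, hx⟩ := (smul_prefix g v (v ++ w)).2 (List.prefix_append v w)
  rw [secFun, ← hx, ← length_smul g v, List.drop_left]

theorem secFun_eq_iff (g : W H) (v w x : Vertex d) :
    secFun g v w = x ↔ g • (v ++ w) = g • v ++ x := by
  rw [smul_append]; simp

theorem secFun_mul (g h : W H) (v w : Vertex d) :
    secFun (g * h) v w = secFun g (h • v) (secFun h v w) := by
  rw [secFun_eq_iff, mul_smul, mul_smul, smul_append, smul_append]

theorem secFun_one (v w : Vertex d) : secFun (1 : W H) v w = w := by
  rw [secFun_eq_iff]; simp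

/-- The local cocycle `β(g, v) ∈ W(H)`: the action of `g` from the subtree below `v` to the subtree
below `g v`, both identified with `T` by deleting the prefixes `v` and `g v`, so that
`g (v w) = (g v) (β(g, v) w)` for every word `w`. -/
def β (g : W H) (v : Vertex d) : W H :=
  ⟨{ toFun := secFun g v
     invFun := secFun g⁻¹ (g • v)
     left_inv := fun w => by rw [← secFun_mul]; simp [secFun_one]
     right_inv := fun w => by
      have := secFun_mul g g⁻¹ (g • v) w
      rw [inv_smul_smul] at this
      rw [← this]; simp [secFun_one] },
    by
      refine ⟨⟨fun w => ?_, fun u w => ?_⟩, fun u => ?_⟩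
      · have h := congrArg List.length (smul_append g v w)
        rw [length_smul, List.length_append, List.length_append, length_smul] at h
        exact (Nat.add_left_cancel h).symm
      · have h := smul_prefix g (v ++ u) (v ++ w)
        rw [smul_append, smul_append, List.prefix_append_right_inj,
          List.prefix_append_right_inj] at h
        exact h
      · obtain ⟨h, hh, hi⟩ := g.2.2 (v ++ u)
        refine ⟨h, hh, fun i => ?_⟩
        change secFun g v (u ++ [i]) = secFun g v u ++ [h i]
        rw [secFun_eq_iff, ← List.append_assoc, ← List.append_assoc, ← smul_append]
        exact hi i⟩

theorem smul_append_eq (g : W H) (v w : Vertex d) : g • (v ++ w) = g • v ++ β g v • w :=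
  smul_append g v w

/-- The cocycle identity. -/
theorem β_mul (g h : W H) (v : Vertex d) : β (g * h) v = β g (h • v) * β h v :=
  Subtype.ext (Equiv.ext fun w => secFun_mul g h v w)

theorem β_one (v : Vertex d) : β (1 : W H) v = 1 :=
  Subtype.ext (Equiv.ext fun w => secFun_one v w)

/-- The group `β(G_v, v) = {β(g, v) | g ∈ G, g v = v}`. -/
def localGroup (G : Subgroup (W H)) (v : Vertex d) : Subgroup (W H) where
  carrier := {x | ∃ g ∈ G, g • v = v ∧ β g v = x}
  one_mem' := ⟨1, one_mem _, one_smul _ _, β_one v⟩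
  mul_mem' := by
    rintro _ _ ⟨g, hg, hgv, rfl⟩ ⟨h, hh, hhv, rfl⟩
    exact ⟨g * h, mul_mem hg hh, by rw [mul_smul, hhv, hgv], by rw [β_mul, hhv]⟩
  inv_mem' := by
    rintro _ ⟨g, hg, hgv, rfl⟩
    have hv : g⁻¹ • v = v := by rw [inv_smul_eq_iff, hgv]
    refine ⟨g⁻¹, inv_mem hg, hv, ?_⟩
    have := β_mul g⁻¹ g v
    rw [inv_mul_cancel, β_one, hgv] at this
    exact eq_inv_of_mul_eq_one_left this.symm

/-! ### Topology and Haar measure -/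

/-- The topology of pointwise convergence on the discrete set of vertices (equivalently, the one
of the ultrametric for which `a` and `b` are close if they agree on many levels). -/
instance : TopologicalSpace (W H) :=
  TopologicalSpace.induced (fun g (v : Vertex d) => g • v)
    (@Pi.topologicalSpace (Vertex d) (fun _ => Vertex d) (fun _ => ⊥))

theorem le_nhds_iff (l : Filter (W H)) (g : W H) :
    l ≤ 𝓝 g ↔ ∀ v : Vertex d, ∀ᶠ x in l, x • v = g • v := by
  let _ : TopologicalSpace (Vertex d) := ⊥
  have : DiscreteTopology (Vertex d) := ⟨rfl⟩
  have h : 𝓝 g = comap (fun (x : W H) (v : Vertex d) => x • v) (𝓝 fun v => g • v) :=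
    nhds_induced _ _
  rw [h, ← tendsto_iff_comap, tendsto_pi_nhds]
  simp only [nhds_discrete, tendsto_pure]

theorem eventually_smul_eq (g : W H) (v : Vertex d) : ∀ᶠ x in 𝓝 g, x • v = g • v :=
  (le_nhds_iff _ g).1 le_rfl v

theorem tendsto_iff {X : Type*} (l : Filter X) (f : X → W H) (g : W H) :
    Tendsto f l (𝓝 g) ↔ ∀ v : Vertex d, ∀ᶠ x in l, f x • v = g • v :=
  le_nhds_iff _ g

instance : IsTopologicalGroup (W H) where
  continuous_mul := by
    rw [continuous_iff_continuousAt]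
    rintro ⟨g, h⟩
    rw [ContinuousAt, tendsto_iff]
    intro v
    rw [nhds_prod_eq]
    filter_upwards [(eventually_smul_eq g (h • v)).prod_mk (eventually_smul_eq h v)] with p hp
    rw [mul_smul, mul_smul, hp.2, hp.1]
  continuous_inv := by
    rw [continuous_iff_continuousAt]
    intro g
    rw [ContinuousAt, tendsto_iff]
    intro v
    filter_upwards [eventually_smul_eq g (g⁻¹ • v)] with x hx
    rw [inv_smul_eq_iff, hx, smul_inv_smul]

theorem exists_eventually_eq (l : Ultrafilter (W H)) (f : W H → Vertex d) (n : ℕ)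
    (hf : ∀ g, (f g).length = n) : ∃ w, ∀ᶠ g in (l : Filter (W H)), f g = w := by
  have hfin : {w : Vertex d | w.length = n}.Finite := List.finite_length_eq (Fin d) n
  have h : (⋃ w ∈ {w : Vertex d | w.length = n}, {g | f g = w}) ∈ l := by
    have hu : (⋃ w ∈ {w : Vertex d | w.length = n}, {g | f g = w}) = Set.univ := by
      ext g
      simp [hf]
    rw [hu]
    exact univ_mem
  obtain ⟨w, -, hw⟩ := (Ultrafilter.finite_biUnion_mem_iff hfin).1 h
  exact ⟨w, hw⟩

instance : CompactSpace (W H) := by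
  refine ⟨isCompact_iff_ultrafilter_le_nhds.2 fun l _ => ?_⟩
  choose f hf using fun v : Vertex d =>
    exists_eventually_eq l (fun g => g • v) v.length fun g => length_smul g v
  choose f' hf' using fun v : Vertex d =>
    exists_eventually_eq l (fun g => g⁻¹ • v) v.length fun g => length_smul g⁻¹ v
  let e : Equiv.Perm (Vertex d) :=
    { toFun := f
      invFun := f'
      left_inv := fun v => by
        obtain ⟨g, h₁, h₂⟩ := ((hf v).and (hf' (f v))).exists
        rw [← h₂, ← h₁, inv_smul_smul]
      right_inv := fun v => by
        obtain ⟨g, h₁, h₂⟩ := ((hf' v).and (hf (f' v))).exists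
        rw [← h₂, ← h₁, smul_inv_smul] }
  have he : e ∈ W H := by
    refine ⟨⟨fun v => ?_, fun v w => ?_⟩, fun v => ?_⟩
    · obtain ⟨g, hg⟩ := (hf v).exists
      change (f v).length = _
      rw [← hg, length_smul]
    · obtain ⟨g, h₁, h₂⟩ := ((hf v).and (hf w)).exists
      change f v <+: f w ↔ _
      rw [← h₁, ← h₂, smul_prefix]
    · obtain ⟨g, h₁, h₂⟩ :=
        ((hf v).and (eventually_all.2 fun i : Fin d => hf (v ++ [i]))).exists
      obtain ⟨h, hh, hi⟩ := g.2.2 v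
      refine ⟨h, hh, fun i => ?_⟩
      change f (v ++ [i]) = f v ++ [h i]
      rw [← h₁, ← h₂ i]
      exact hi i
  exact ⟨⟨e, he⟩, Set.mem_univ _, (le_nhds_iff _ _).2 hf⟩

instance : MeasurableSpace (W H) := borel _

instance : BorelSpace (W H) := ⟨rfl⟩

/-- The Haar probability measure of the compact group `W(H)`. -/
noncomputable def haar (H : Subgroup (Equiv.Perm (Fin d))) : Measure (W H) :=
  Measure.haarMeasure ⊤

instance : IsProbabilityMeasure (haar H) :=
  ⟨Measure.haarMeasure_self (K₀ := (⊤ : TopologicalSpace.PositiveCompacts (W H)))⟩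

/-- The law of `k` independent Haar-random elements of `W(H)`.  A point `a` of `W(H)^k` is
identified with the homomorphism `FreeGroup.lift a` from the free group `F_k` to `W(H)` that sends
the `i`-th generator to `a i`, so this is the probability measure on `Hom(F_k, W(H))`. -/
noncomputable def homMeasure (H : Subgroup (Equiv.Perm (Fin d))) (k : ℕ) :
    Measure (Fin k → W H) :=
  Measure.pi fun _ => haar H

/-! ### Hausdorff dimension -/

/-- `W(H)^[n]`: the pointwise stabilizer of the `n`-th level of the tree. -/
def levelStab (H : Subgroup (Equiv.Perm (Fin d))) (n : ℕ) : Subgroup (W H) :=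
  ⨅ (v : Vertex d) (_ : v.length = n), MulAction.stabilizer (W H) v

/-- The order of `G_n = G / G^[n]`, where `G^[n] = G ∩ W(H)^[n]` is the pointwise stabilizer in
`G` of the `n`-th level. -/
noncomputable def levelCard (G : Subgroup (W H)) (n : ℕ) : ℕ :=
  Nat.card (G ⧸ (levelStab H n).subgroupOf G)

/-- The density sequence `γ_n(G) = log |G_n| / log |W_n|`. -/
noncomputable def density (G : Subgroup (W H)) (n : ℕ) : ℝ :=
  Real.log (levelCard G n) / Real.log (levelCard (⊤ : Subgroup (W H)) n)

/-- The Hausdorff dimension `dim_H G = liminf γ_n(G)` of a subgroup of `W(H)`. -/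
noncomputable def hdim (G : Subgroup (W H)) : ℝ :=
  liminf (density G) atTop

/-- `L(n) / G`: the set of orbits of `G` on the `n`-th level of the tree. -/
def levelOrbits (G : Subgroup (W H)) (n : ℕ) : Set (Set (Vertex d)) :=
  {Z | ∃ u : Vertex d, u.length = n ∧ Z = MulAction.orbit G u}

end IteratedWreath

open MeasureTheory IteratedWreath

/-! Given the action of the random generators on a level, their sections `β` at the vertices of that
level are independent and Haar distributed. By the cocycle identity the section of a word at `v` is
the product of such sections or their inverses along its path in the Schreier graph of the level. If
the path uses some edge exactly once, the section is `A * c ^ (±1) * B`, with `c` attached to that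
edge and `A`, `B` independent of `c`. So elements with private edges have independent Haar sections,
given the level action (`measure_levelAction_inter_preimage`).

It thus suffices to find, in every orbit of `Δ` on some level, a vertex `v` and `K` elements of `Δ`
that fix `v` and have private edges. Their sections generate a copy of a random `K`-generated group,
which has positive dimension by hypothesis. Passing from the local group at `v` to `φ(Δ)` costs a
factor `d ^ N`, because `log |W_{n+N}| ≤ log |W_N| + d ^ N * log |W_n|` (`hdim_localGroup_div_le`).

The loops have two sources. Probability: the fixed vertices of a Haar-random element form a
branching process, critical by transitivity and not degenerate, hence almost surely extinct
(`ae_exists_mem_derangements`). Induction on the length, again through private edges, extends this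
to all nontrivial words, so for every `R` some level has no loops of reduced words of length at most
`R` (`ae_forall_exists_freeUpTo`). Combinatorics (`exists_private_loops`): a conjugate of `Δ`
contains many code words of equal length `n`, more than any prescribed multiple of `n`. Join each
orbit point `z` to `c² z` for every code word `c` and mark the middle edge of each such path. Random
sampling yields a dense subgraph in which no marked edge lies on another path; there the chords of a
spanning forest close up to loops with private edges.

The radius `R` depends on `Δ` alone, while the absence of short loops holds for all `R` at once, so
a single null set serves the uncountably many `Δ`. `N` is the least level with loops. All choices
depend only on the action on level `N`, so conditioning on them leaves the sections below Haar
distributed. -/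

namespace FreeGroup

/-! ### Reduced words, and codes in non-cyclic subgroups of free groups -/

section Words

variable {ι : Type*}

theorem IsReduced.eq_of_mk_eq {L₁ L₂ : List (ι × Bool)} (h₁ : IsReduced L₁) (h₂ : IsReduced L₂)
    (h : mk L₁ = mk L₂) : L₁ = L₂ := by
  classical
  rw [← h₁.reduce_eq, ← h₂.reduce_eq]
  exact reduce.sound h

theorem IsReduced.mk_ne_one {L : List (ι × Bool)} (h : IsReduced L) (hL : L ≠ []) : mk L ≠ 1 :=
  fun h' => hL (h.eq_of_mk_eq IsReduced.nil h')

theorem mk_cons_eq (l : ι × Bool) (w : List (ι × Bool)) : mk (l :: w) = mk [l] * mk w := by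
  rw [mul_mk]; rfl

theorem finite_norm_le [Finite ι] [DecidableEq ι] (n : ℕ) :
    {g : FreeGroup ι | g.norm ≤ n}.Finite := by
  refine Set.Finite.of_finite_image (f := toWord)
    ((List.finite_length_le (ι × Bool) n).subset ?_) toWord_injective.injOn
  rintro _ ⟨g, hg, rfl⟩
  exact hg

theorem isCyclic_of_subsingleton [Subsingleton ι] : IsCyclic (FreeGroup ι) := by
  rcases isEmpty_or_nonempty ι with h | ⟨⟨a⟩⟩
  · exact ⟨1, fun x => ⟨0, Subsingleton.elim _ _⟩⟩
  · refine ⟨of a, fun x => ?_⟩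
    have hx : x ∈ Subgroup.closure (Set.range (of : ι → FreeGroup ι)) := by
      rw [closure_range_of]; trivial
    refine (Subgroup.closure_le (Subgroup.zpowers (of a))).2 ?_ hx
    rintro _ ⟨b, rfl⟩
    rw [Subsingleton.elim b a]
    exact Subgroup.mem_zpowers _

/-- By the Nielsen–Schreier theorem `Δ` is free, and two distinct free generators do not commute,
since the words `ab` and `ba` are reduced and different. -/
theorem isCyclic_of_forall_commute {Δ : Subgroup (FreeGroup ι)}
    (h : ∀ x ∈ Δ, ∀ y ∈ Δ, x * y = y * x) : IsCyclic Δ := by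
  let e := IsFreeGroup.toFreeGroup Δ
  have hs : Subsingleton (IsFreeGroup.Generators Δ) := by
    refine ⟨fun a b => ?_⟩
    have h1 : e.symm (of a) * e.symm (of b) = e.symm (of b) * e.symm (of a) :=
      Subtype.ext (h _ (e.symm (of a)).2 _ (e.symm (of b)).2)
    rw [← _root_.map_mul e.symm, ← _root_.map_mul e.symm] at h1
    have h2 : mk [(a, true), (b, true)] = mk [(b, true), (a, true)] := e.symm.injective h1
    have h3 := IsReduced.eq_of_mk_eq (by simp) (by simp) h2
    simpa using congrArg List.head? h3
  have := isCyclic_of_subsingleton (ι := IsFreeGroup.Generators Δ)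
  exact isCyclic_of_surjective e.symm e.symm.surjective

/-- A nontrivial element of a free group has no power that is conjugate to its inverse. -/
theorem conj_pow_ne_inv {U Y : FreeGroup ι} (hU : U ≠ 1) {k : ℕ} (hk : k ≠ 0) :
    Y * U ^ k * Y⁻¹ ≠ (U ^ k)⁻¹ := by
  intro h
  set V := U ^ k with hV
  have hV1 : V ≠ 1 := fun h1 => hU ((pow_eq_one_iff_left hk).1 h1)
  have hc : Commute (Y ^ 2) V := by
    have h2 : Y * V⁻¹ * Y⁻¹ = V := by
      have := congrArg (·⁻¹) h
      simpa [mul_assoc] using this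
    have h3 : Y ^ 2 * V * (Y ^ 2)⁻¹ = V := by
      calc Y ^ 2 * V * (Y ^ 2)⁻¹ = Y * (Y * V * Y⁻¹) * Y⁻¹ := by rw [sq]; group
        _ = V := by rw [h, h2]
    exact mul_inv_eq_iff_eq_mul.1 h3
  have hcyc : IsCyclic (Subgroup.closure {Y ^ 2, V}) := by
    refine isCyclic_of_forall_commute fun x hx y hy => ?_
    have := Subgroup.isMulCommutative_closure (k := {Y ^ 2, V}) (by
      rintro a (rfl | rfl) b (rfl | rfl)
      · rfl
      · exact hc
      · exact hc.symm
      · rfl)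
    exact congrArg Subtype.val (mul_comm' (⟨x, hx⟩ : Subgroup.closure {Y ^ 2, V}) ⟨y, hy⟩)
  obtain ⟨⟨c, hcm⟩, hgen⟩ := hcyc
  obtain ⟨a, ha⟩ := hgen ⟨Y ^ 2, Subgroup.subset_closure (by simp)⟩
  obtain ⟨b, hb⟩ := hgen ⟨V, Subgroup.subset_closure (by simp)⟩
  replace ha : c ^ a = Y ^ 2 := congrArg Subtype.val ha
  replace hb : c ^ b = V := congrArg Subtype.val hb
  -- This common power commutes with `Y`, yet conjugation by `Y` inverts it. Torsion-freeness then
  -- gives `V ^ a = 1`, so `a = 0`, `Y = 1` and `V ^ 2 = 1`.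
  have hpow : (Y ^ 2) ^ b = V ^ a := by
    rw [← ha, ← hb, ← zpow_mul, ← zpow_mul, mul_comm]
  have hYV : Y * V ^ a * Y⁻¹ = V ^ a := by
    rw [← hpow, mul_inv_eq_iff_eq_mul]
    exact ((Commute.refl Y).pow_right 2).zpow_right b
  have hYV' : Y * V ^ a * Y⁻¹ = (V ^ a)⁻¹ := by
    rw [← conj_zpow, h, inv_zpow]
  have hsq : V ^ a = 1 := by
    have : (V ^ a) ^ 2 = 1 := by
      rw [sq]
      nth_rw 1 [← hYV, hYV']
      simp
    exact (pow_eq_one_iff_left two_ne_zero).1 this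
  have ha0 : a = 0 := by
    by_contra ha0
    exact hV1 ((IsMulTorsionFree.zpow_eq_one_iff_left ha0).1 hsq)
  rw [ha0, zpow_zero] at ha
  have hY : Y = 1 := (pow_eq_one_iff_left two_ne_zero).1 ha.symm
  rw [hY] at h
  have : V ^ 2 = 1 := by
    rw [sq]
    nth_rw 1 [show V = V⁻¹ by simpa using h]
    simp
  exact hV1 ((pow_eq_one_iff_left two_ne_zero).1 this)

theorem IsReduced.append_of {A B : List (ι × Bool)} (hA : IsReduced A) (hB : IsReduced B)
    (h : ∀ a ∈ A.getLast?, ∀ b ∈ B.head?, a.1 = b.1 → a.2 = b.2) : IsReduced (A ++ B) :=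
  List.isChain_append.2 ⟨hA, hB, h⟩

theorem IsReduced.left {A B : List (ι × Bool)} (h : IsReduced (A ++ B)) : IsReduced A :=
  h.infix ⟨[], B, rfl⟩

theorem IsReduced.right {A B : List (ι × Bool)} (h : IsReduced (A ++ B)) : IsReduced B :=
  h.infix ⟨A, [], by simp⟩

/-- The product of two reduced words is reduced by a single cancellation. -/
theorem IsReduced.exists_cancel {A : List (ι × Bool)} (hA : IsReduced A) :
    ∀ {B : List (ι × Bool)}, IsReduced B →
      ∃ A' C B', A = A' ++ C ∧ B = invRev C ++ B' ∧ IsReduced (A' ++ B') := by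
  induction A using List.reverseRecOn with
  | nil => exact fun {B} hB => ⟨[], [], B, by simp, by simp, by simpa⟩
  | append_singleton A l ih =>
    intro B hB
    by_cases hb : B.head? = some (l.1, !l.2)
    · obtain ⟨B₁, rfl⟩ : ∃ B₁, B = (l.1, !l.2) :: B₁ := by
        cases B with
        | nil => simp at hb
        | cons b B₁ =>
          rw [List.head?_cons, Option.some.injEq] at hb
          subst hb
          exact ⟨B₁, rfl⟩
      obtain ⟨A', C, B', h1, h2, h3⟩ := ih hA.left (B := B₁)
        (hB.infix ⟨[(l.1, !l.2)], [], by simp⟩)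
      refine ⟨A', C ++ [l], B', by simp [h1], ?_, h3⟩
      rw [invRev_append, h2]
      simp [invRev]
    · refine ⟨A ++ [l], [], B, by simp, by simp, hA.append_of hB ?_⟩
      intro a ha b hbb h1
      simp only [List.getLast?_append, List.getLast?_singleton, Option.some_or,
        Option.mem_def, Option.some.injEq] at ha
      subst ha
      by_contra h2
      apply hb
      rw [Option.mem_def] at hbb
      rw [hbb]
      congr 1
      ext
      · exact h1.symm
      · simpa using (Bool.eq_not_of_ne (Ne.symm h2))

/-- The reduced words with first letter `s` and last letter `t`. -/
structure ReducedFromTo (s t : ι × Bool) (w : List (ι × Bool)) : Prop where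
  isReduced : IsReduced w
  head : w.head? = some s
  last : w.getLast? = some t

theorem ReducedFromTo.append {s t : ι × Bool} (hst : t.1 = s.1 → t.2 = s.2)
    {w x : List (ι × Bool)} (hw : ReducedFromTo s t w) (hx : ReducedFromTo s t x) :
    ReducedFromTo s t (w ++ x) where
  isReduced := hw.1.append_of hx.1 <| by simpa [hw.last, hx.head] using hst
  head := by simp [List.head?_append, hw.head]
  last := by simp [List.getLast?_append, hx.last]

/-- Every non-abelian subgroup of a free group contains, up to conjugation, two different words of
the same length, any concatenation of which is reduced. -/
theorem exists_reducedFromTo_of_not_isCyclic [Finite ι] {Δ : Subgroup (FreeGroup ι)}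
    (hΔ : ¬ IsCyclic Δ) : ∃ (p : List (ι × Bool)) (s t : ι × Bool) (g h : List (ι × Bool)),
      (t.1 = s.1 → t.2 = s.2) ∧ ReducedFromTo s t g ∧ ReducedFromTo s t h ∧ g ≠ h ∧
      g.length = h.length ∧ mk p * mk g * (mk p)⁻¹ ∈ Δ ∧ mk p * mk h * (mk p)⁻¹ ∈ Δ := by
  classical
  obtain ⟨x, hx, y, hy, hxy⟩ : ∃ x ∈ Δ, ∃ y ∈ Δ, x * y ≠ y * x := by
    by_contra! h
    exact hΔ (isCyclic_of_forall_commute h)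
  set p := reduceCyclically.conjugator x.toWord with hp
  set u := reduceCyclically x.toWord with hu
  have hcu : IsCyclicallyReduced u := reduceCyclically.isCyclicallyReduced isReduced_toWord
  have hxu : x = mk p * mk u * (mk p)⁻¹ := by
    rw [inv_mk, mul_mk, mul_mk, hp, hu, reduceCyclically.conj_conjugator_reduceCyclically,
      mk_toWord]
  set U := mk u with hU
  set Y := (mk p)⁻¹ * y * mk p with hY
  have hyY : y = mk p * Y * (mk p)⁻¹ := by rw [hY]; group
  have hUY : U * Y ≠ Y * U := by
    intro h
    apply hxy
    calc x * y = mk p * (U * Y) * (mk p)⁻¹ := by rw [hxu, hyY]; group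
      _ = y * x := by rw [h, hxu, hyY]; group
  have hu0 : u ≠ [] := by
    intro h
    apply hUY
    rw [hU, h, show mk ([] : List (ι × Bool)) = 1 from rfl]
    simp
  have hU1 : U ≠ 1 := hcu.1.mk_ne_one hu0
  have hword (N : ℕ) : (U ^ N).toWord = (List.replicate N u).flatten := by
    rw [hU, pow_mk, toWord_mk, (hcu.flatten_replicate N).1.reduce_eq]
  have hlen (N : ℕ) : (U ^ N).toWord.length = N * u.length := by
    rw [hword]; simp
  -- Otherwise infinitely many `N` give elements of a finite ball, so two coincide. This makes some
  -- `U ^ (k + 1)` conjugate under `Y` to its inverse.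
  obtain ⟨N, hN⟩ : ∃ N : ℕ, Y.norm < (U ^ N * Y * U ^ N).norm := by
    by_contra! h
    have hfin := finite_norm_le (ι := ι) Y.norm
    obtain ⟨a, -, b, -, hab, heq⟩ := Set.infinite_univ.exists_ne_map_eq_of_mapsTo
      (f := fun N : ℕ => U ^ N * Y * U ^ N) (fun N _ => h N) hfin
    wlog hlt : a < b generalizing a b
    · exact this b a hab.symm heq.symm (by omega)
    obtain ⟨k, rfl⟩ := Nat.exists_eq_add_of_lt hlt
    have h1 : U ^ a * Y * U ^ a = U ^ a * (U ^ (k + 1) * Y * U ^ (k + 1)) * U ^ a := by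
      rw [show U ^ a * Y * U ^ a = U ^ (a + k + 1) * Y * U ^ (a + k + 1) from heq]
      rw [show a + k + 1 = a + (k + 1) by ring, pow_add]
      nth_rw 2 [(Commute.pow_pow_self U a (k + 1)).eq]
      group
    have h2 : Y = U ^ (k + 1) * Y * U ^ (k + 1) := mul_left_cancel (mul_right_cancel h1)
    refine conj_pow_ne_inv (Y := Y) hU1 (Nat.succ_ne_zero k) ?_
    rw [mul_inv_eq_iff_eq_mul, eq_inv_mul_iff_mul_eq, ← mul_assoc]
    exact h2.symm
  set T := U ^ N * Y * U ^ N with hT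
  have hN0 : N ≠ 0 := by
    rintro rfl
    simp [hT] at hN
  -- If the left factor `U ^ N` cancelled entirely, the norm of `T` would be at most that of `Y`. So
  -- the first letter of `u` survives; symmetrically for the last letter.
  have hhead : T.toWord.head? = u.head? := by
    obtain ⟨A', C, B', h1, h2, h3⟩ := (isReduced_toWord (x := U ^ N)).exists_cancel
      (isReduced_toWord (x := Y * U ^ N))
    have hTw : T.toWord = A' ++ B' := by
      rw [← h3.reduce_eq, ← toWord_mk, ← mul_mk]
      congr 1
      have e1 : U ^ N = mk A' * mk C := by rw [mul_mk, ← h1, mk_toWord]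
      have e2 : Y * U ^ N = (mk C)⁻¹ * mk B' := by rw [inv_mk, mul_mk, ← h2, mk_toWord]
      rw [hT, mul_assoc, e2, e1]
      group
    have hA' : A' ≠ [] := by
      rintro rfl
      have l1 := congrArg List.length h1
      have l2 := congrArg List.length h2
      have l3 : (Y * U ^ N).toWord.length ≤ Y.norm + (U ^ N).toWord.length := norm_mul_le Y (U ^ N)
      have l4 : T.norm = B'.length := by rw [norm, hTw]; rfl
      simp only [List.length_append, invRev_length, List.length_nil] at l1 l2
      omega
    have h4 : A'.head? = u.head? := by
      have := congrArg List.head? h1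
      rw [hword, List.head?_flatten_replicate hN0, List.head?_append_of_ne_nil _ hA'] at this
      exact this.symm
    rw [hTw, List.head?_append_of_ne_nil _ hA', h4]
  have hlast : T.toWord.getLast? = u.getLast? := by
    obtain ⟨A', C, B', h1, h2, h3⟩ := (isReduced_toWord (x := U ^ N * Y)).exists_cancel
      (isReduced_toWord (x := U ^ N))
    have hTw : T.toWord = A' ++ B' := by
      rw [← h3.reduce_eq, ← toWord_mk, ← mul_mk]
      congr 1
      have e1 : U ^ N * Y = mk A' * mk C := by rw [mul_mk, ← h1, mk_toWord]
      have e2 : U ^ N = (mk C)⁻¹ * mk B' := by rw [inv_mk, mul_mk, ← h2, mk_toWord]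
      rw [hT, e1, e2]
      group
    have hB' : B' ≠ [] := by
      rintro rfl
      have l1 := congrArg List.length h1
      have l2 := congrArg List.length h2
      have l3 : (U ^ N * Y).toWord.length ≤ (U ^ N).toWord.length + Y.norm := norm_mul_le (U ^ N) Y
      have l4 : T.norm = A'.length := by rw [norm, hTw]; simp
      simp only [List.length_append, invRev_length, List.length_nil] at l1 l2
      omega
    have h4 : B'.getLast? = u.getLast? := by
      have := congrArg List.getLast? h2
      rw [hword, List.getLast?_flatten_replicate hN0, List.getLast?_append_of_ne_nil _ hB'] at this
      exact this.symm
    rw [hTw, List.getLast?_append_of_ne_nil _ hB', h4]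
  have hu1 : ReducedFromTo (u.head hu0) (u.getLast hu0) u :=
    ⟨hcu.1, List.head?_eq_some_head hu0, List.getLast?_eq_some_getLast hu0⟩
  have hT1 : ReducedFromTo (u.head hu0) (u.getLast hu0) T.toWord :=
    ⟨isReduced_toWord, hhead.trans hu1.head, hlast.trans hu1.last⟩
  -- Since `u` is cyclically reduced, its last letter may be followed by its first one.
  have hst := hcu.2 _ hu1.last _ hu1.head
  have hTΔ : mk p * T * (mk p)⁻¹ ∈ Δ := by
    have : mk p * T * (mk p)⁻¹ = x ^ N * y * x ^ N := by
      rw [hxu, hyY, conj_pow, hT]; group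
    rw [this]
    exact mul_mem (mul_mem (pow_mem hx N) hy) (pow_mem hx N)
  -- The words `uT` and `Tu` have equal length and differ because `U` and `Y` do not commute.
  refine ⟨p, _, _, u ++ T.toWord, T.toWord ++ u, hst, hu1.append hst hT1, hT1.append hst hu1, ?_,
    by simp [add_comm], ?_, ?_⟩
  · intro h
    have h1 := congrArg mk h
    rw [← mul_mk, ← mul_mk, mk_toWord, ← hU] at h1
    apply hUY
    have h2 : U ^ N * (U * Y) * U ^ N = U ^ N * (Y * U) * U ^ N := by
      calc U ^ N * (U * Y) * U ^ N = U * T := by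
            rw [hT, ← mul_assoc (U ^ N), ← pow_succ, pow_succ']; group
        _ = T * U := h1
        _ = U ^ N * (Y * U) * U ^ N := by
            rw [hT, mul_assoc (U ^ N * Y), ← pow_succ, pow_succ']; group
    exact mul_left_cancel (mul_right_cancel h2)
  · rw [← mul_mk, mk_toWord]
    have : mk p * (mk u * T) * (mk p)⁻¹ = x * (mk p * T * (mk p)⁻¹) := by rw [hxu, ← hU]; group
    rw [this]
    exact mul_mem hx hTΔ
  · rw [← mul_mk, mk_toWord]
    have : mk p * (T * mk u) * (mk p)⁻¹ = (mk p * T * (mk p)⁻¹) * x := by rw [hxu, ← hU]; group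
    rw [this]
    exact mul_mem hTΔ hx

theorem length_flatMap_cond {g h : List (ι × Bool)} (hgh : g.length = h.length) (bs : List Bool) :
    (bs.flatMap fun b => cond b g h).length = bs.length * g.length := by
  induction bs with
  | nil => simp
  | cons b bs ih =>
    rw [List.flatMap_cons, List.length_append, ih, List.length_cons]
    cases b <;> simp [hgh] <;> ring

theorem flatMap_cond_injective {g h : List (ι × Bool)} (hgh : g.length = h.length) (hne : g ≠ h)
    {bs cs : List Bool} (hl : bs.length = cs.length)
    (heq : (bs.flatMap fun b => cond b g h) = cs.flatMap fun b => cond b g h) : bs = cs := by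
  induction bs generalizing cs with
  | nil => exact (List.eq_nil_of_length_eq_zero hl.symm).symm
  | cons b bs ih =>
    cases cs with
    | nil => simp at hl
    | cons c cs =>
      rw [List.flatMap_cons, List.flatMap_cons] at heq
      obtain ⟨h1, h2⟩ := List.append_inj heq (by cases b <;> cases c <;> simp [hgh])
      rw [ih (by simpa using hl) h2]
      cases b <;> cases c <;> simp_all

theorem ReducedFromTo.flatMap_cond {s t : ι × Bool} (hst : t.1 = s.1 → t.2 = s.2)
    {g h : List (ι × Bool)} (hg : ReducedFromTo s t g) (hh : ReducedFromTo s t h) {bs : List Bool}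
    (hbs : bs ≠ []) : ReducedFromTo s t (bs.flatMap fun b => cond b g h) := by
  induction bs with
  | nil => exact absurd rfl hbs
  | cons b bs ih =>
    have hb : ReducedFromTo s t (cond b g h) := by cases b <;> assumption
    rw [List.flatMap_cons]
    rcases eq_or_ne bs [] with rfl | h0
    · simpa using hb
    · exact hb.append hst (ih h0)

theorem conj_flatMap_cond_mem {Δ : Subgroup (FreeGroup ι)} {p : FreeGroup ι}
    {g h : List (ι × Bool)} (hg : p * mk g * p⁻¹ ∈ Δ) (hh : p * mk h * p⁻¹ ∈ Δ) (bs : List Bool) :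
    p * mk (bs.flatMap fun b => cond b g h) * p⁻¹ ∈ Δ := by
  induction bs with
  | nil => simp [show mk ([] : List (ι × Bool)) = 1 from rfl]
  | cons b bs ih =>
    have hb : p * mk (cond b g h) * p⁻¹ ∈ Δ := by cases b <;> assumption
    rw [List.flatMap_cons, ← mul_mk]
    have := mul_mem hb ih
    rwa [show ∀ x y : FreeGroup ι, p * x * p⁻¹ * (p * y * p⁻¹) = p * (x * y) * p⁻¹ from
      fun x y => by group] at this

/-- Up to conjugation, a non-cyclic subgroup of a free group contains large families of different
words of the same length, any concatenation of which is reduced; the number of the words exceeds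
any given multiple of their length. -/
theorem exists_code_of_not_isCyclic [Finite ι] {Δ : Subgroup (FreeGroup ι)}
    (hΔ : ¬ IsCyclic Δ) : ∃ (p : List (ι × Bool)) (s t : ι × Bool), (t.1 = s.1 → t.2 = s.2) ∧
      ∀ B : ℕ, ∃ n ≥ 2, ∀ q ≤ B * (n + 1), ∃ c : Fin q → List (ι × Bool), Function.Injective c ∧
        ∀ i, (c i).length = n ∧ ReducedFromTo s t (c i) ∧ mk p * mk (c i) * (mk p)⁻¹ ∈ Δ := by
  obtain ⟨p, s, t, g, h, hst, hg, hh, hne, hgh, hgΔ, hhΔ⟩ :=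
    exists_reducedFromTo_of_not_isCyclic hΔ
  refine ⟨p, s, t, hst, fun B => ?_⟩
  have hL : 1 ≤ g.length := by
    rcases g with _ | ⟨a, g⟩
    · simpa using hg.head
    · simp
  set L := g.length
  set k := B * (2 * L + 1) + 1
  -- The code consists of the `4 ^ k` products of `2 * k` factors `g` or `h`. The choice of `k`
  -- gives `B * (2 * k * L + 1) ≤ k * k ≤ 4 ^ k`.
  refine ⟨2 * k * L, ?_, fun q hq => ?_⟩
  · have : 1 ≤ k := by omega
    nlinarith
  have hq2 : q ≤ 2 ^ (2 * k) := by
    have h1 : k < 2 ^ k := Nat.lt_two_pow_self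
    have h2 : 2 ^ (2 * k) = 2 ^ k * 2 ^ k := by rw [two_mul, pow_add]
    have h3 : B * (2 * k * L + 1) ≤ B * (2 * L + 1) * k := by
      have : 1 ≤ k := by omega
      calc B * (2 * k * L + 1) ≤ B * (2 * k * L + k) := by gcongr
        _ = B * (2 * L + 1) * k := by ring
    have h4 : B * (2 * L + 1) * k ≤ k * k := Nat.mul_le_mul_right _ (by omega)
    have h5 : k * k ≤ 2 ^ k * 2 ^ k := Nat.mul_le_mul h1.le h1.le
    omega
  obtain ⟨e⟩ : Nonempty (Fin q ↪ (Fin (2 * k) → Bool)) :=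
    Function.Embedding.nonempty_of_card_le (by simpa using hq2)
  refine ⟨fun i => (List.ofFn (e i)).flatMap fun b => cond b g h, fun i j hij => ?_,
    fun i => ⟨by rw [length_flatMap_cond hgh, List.length_ofFn], hg.flatMap_cond hst hh ?_,
      conj_flatMap_cond_mem hgΔ hhΔ _⟩⟩
  · exact e.injective (List.ofFn_injective (flatMap_cond_injective hgh hne (by simp) hij))
  · intro h0
    have := congrArg List.length h0
    simp [k] at this

end Words

/-! ### Paths in Schreier graphs -/

section Paths

variable {ι G V : Type*} [Group G] [MulAction G V]

/-- The edges of the Schreier graph that are traversed by the word `w`, read from right to left,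
starting from `v`.  The edge from `u` to `φ (of i) • u` is encoded as `(i, u)`. -/
def edges (φ : FreeGroup ι →* G) (v : V) : List (ι × Bool) → List (ι × V)
  | [] => []
  | l :: w => (l.1, if l.2 then φ (mk w) • v else φ (mk (l :: w)) • v) :: edges φ v w

/-- The nontrivial elements given by words of length at most `R` fix no point of the orbit. -/
def FreeUpTo (φ : FreeGroup ι →* G) (R : ℕ) (v : V) : Prop :=
  ∀ w : List (ι × Bool), IsReduced w → w ≠ [] → w.length ≤ R →
    ∀ x, φ (mk w) • φ x • v ≠ φ x • v

variable {φ : FreeGroup ι →* G}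

@[simp]
theorem edges_nil (v : V) : edges φ v [] = [] := rfl

theorem edges_cons (v : V) (l : ι × Bool) (w : List (ι × Bool)) :
    edges φ v (l :: w) =
      (l.1, if l.2 then φ (mk w) • v else φ (mk (l :: w)) • v) :: edges φ v w := rfl

theorem length_edges (v : V) (w : List (ι × Bool)) : (edges φ v w).length = w.length := by
  induction w with
  | nil => rfl
  | cons l w ih => simp [edges_cons, ih]

theorem mk_append_smul (v : V) (w x : List (ι × Bool)) :
    φ (mk (w ++ x)) • v = φ (mk w) • φ (mk x) • v := by
  rw [← mul_mk, _root_.map_mul, mul_smul]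

theorem edges_append (v : V) (w x : List (ι × Bool)) :
    edges φ v (w ++ x) = edges φ (φ (mk x) • v) w ++ edges φ v x := by
  induction w with
  | nil => simp
  | cons l w ih =>
    rw [List.cons_append, edges_cons, edges_cons, ih, mk_append_smul,
      ← mk_append_smul v (l :: w) x]
    rfl

/-- The encoding of an edge forgets the direction of traversal, so the inverse word retraces the
same edges. -/
theorem mem_edges_invRev {v : V} {w : List (ι × Bool)} {e : ι × V} :
    e ∈ edges φ (φ (mk w) • v) (invRev w) ↔ e ∈ edges φ v w := by
  induction w with
  | nil => simp
  | cons l w ih =>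
    have h1 : φ (mk (invRev [l])) • φ (mk (l :: w)) • v = φ (mk w) • v := by
      rw [mk_cons_eq l w, _root_.map_mul, mul_smul, ← inv_mk, _root_.map_inv, inv_smul_smul]
    rw [invRev_cons, edges_append, List.mem_append, h1, ih, edges_cons, List.mem_cons, or_comm]
    have h2 : edges φ (φ (mk (l :: w)) • v) (invRev [l]) =
        [(l.1, if l.2 then φ (mk w) • v else φ (mk (l :: w)) • v)] := by
      obtain ⟨i, b⟩ := l
      cases b
      · change [(i, φ 1 • φ (mk ((i, false) :: w)) • v)] = _
        simp
      · rw [← h1]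
        rfl
    rw [h2, List.mem_singleton]

/-- An edge on the path of a word corresponds to a decomposition of the word. -/
theorem exists_of_mem_edges {v : V} {w : List (ι × Bool)} {e : ι × V} (he : e ∈ edges φ v w) :
    ∃ P l Q, w = P ++ l :: Q ∧
      e = (l.1, if l.2 then φ (mk Q) • v else φ (mk (l :: Q)) • v) := by
  induction w with
  | nil => simp at he
  | cons l w ih =>
    rw [edges_cons, List.mem_cons] at he
    rcases he with rfl | he
    · exact ⟨[], l, w, rfl, rfl⟩
    · obtain ⟨P, l', Q, rfl, h⟩ := ih he
      exact ⟨l :: P, l', Q, rfl, h⟩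

/-- Two steps traverse the same edge in the same or in the opposite direction. -/
theorem step_eq_iff {l l' : ι × Bool} {u u' : V} {Q Q' : List (ι × Bool)}
    (h : (l.1, if l.2 then φ (mk Q) • u else φ (mk (l :: Q)) • u) =
      (l'.1, if l'.2 then φ (mk Q') • u' else φ (mk (l' :: Q')) • u')) :
    (l = l' ∧ φ (mk Q) • u = φ (mk Q') • u') ∨
      (l' = (l.1, !l.2) ∧ φ (mk Q) • u = φ (mk (l' :: Q')) • u') := by
  obtain ⟨i, b⟩ := l
  obtain ⟨i', b'⟩ := l'
  obtain ⟨rfl, h2⟩ := Prod.mk.injEq _ _ _ _ ▸ h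
  cases b <;> cases b' <;> simp only [Bool.false_eq_true, if_false, if_true] at h2
  · left
    refine ⟨rfl, ?_⟩
    rw [mk_cons_eq, mk_cons_eq (i, false) Q', _root_.map_mul, _root_.map_mul, mul_smul, mul_smul]
      at h2
    exact smul_left_cancel _ h2
  · right
    refine ⟨rfl, ?_⟩
    have hc : mk [(i, true)] * mk [(i, false)] = 1 := mul_inv_cancel (of i)
    change φ (mk Q) • u = φ (mk ((i, true) :: Q')) • u'
    rw [mk_cons_eq (i, true) Q', _root_.map_mul, mul_smul, ← h2,
      mk_cons_eq (i, false) Q, _root_.map_mul, mul_smul, ← mul_smul (φ (mk [(i, true)])),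
      ← _root_.map_mul, hc, _root_.map_one, one_smul]
  · right
    exact ⟨rfl, h2⟩
  · left
    exact ⟨rfl, h2⟩

theorem FreeUpTo.eq_one {R : ℕ} {v : V} (h : FreeUpTo φ R v) {w : List (ι × Bool)}
    (hw : w.length ≤ R) {x : FreeGroup ι} (hx : φ (mk w) • φ x • v = φ x • v) : mk w = 1 := by
  classical
  by_contra h1
  refine h (mk w).toWord isReduced_toWord (by rwa [ne_eq, toWord_eq_nil_iff]) (le_trans norm_mk_le hw) x ?_
  rwa [mk_toWord]

theorem FreeUpTo.smul {R : ℕ} {v : V} (h : FreeUpTo φ R v) (y : FreeGroup ι) :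
    FreeUpTo φ R (φ y • v) := by
  intro w h1 h2 h3 x
  have := h w h1 h2 h3 (x * y)
  rwa [_root_.map_mul, mul_smul] at this

/-- The path of a reduced word traverses its edges at most once. -/
theorem FreeUpTo.nodup_edges {R : ℕ} {v : V} (h : FreeUpTo φ R v) {w : List (ι × Bool)}
    (hw : IsReduced w) (hR : w.length ≤ R + 1) : (edges φ v w).Nodup := by
  induction w with
  | nil => simp
  | cons l w ih =>
    rw [edges_cons, List.nodup_cons]
    refine ⟨fun hmem => ?_, ih (hw.infix ⟨[l], [], by simp⟩) (by simp at hR; omega)⟩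
    obtain ⟨P, l', Q, hPQ, he⟩ := exists_of_mem_edges hmem
    subst hPQ
    -- In the same direction the subword `P ++ [l]` closes up; in the opposite direction `P` does,
    -- unless it is empty and two adjacent letters cancel. The closed subword misses a letter of the
    -- word, so length `R + 1` is allowed.
    rcases step_eq_iff he with ⟨rfl, h2⟩ | ⟨hl, h2⟩
    · rw [← List.singleton_append (l := Q), ← List.append_assoc, mk_append_smul] at h2
      refine h (P ++ [l]) (hw.infix ⟨[l], Q, by simp⟩) (by simp) ?_ _ h2
      simp at hR ⊢; omega
    · rw [mk_append_smul] at h2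
      rcases eq_or_ne P [] with rfl | hP
      · rw [List.nil_append, isReduced_cons_cons] at hw
        have := hw.1 (by rw [hl])
        rw [hl] at this
        simp at this
      · refine h P (hw.infix ⟨[l], l' :: Q, by simp⟩) hP ?_ _ h2
        simp at hR ⊢; omega

end Paths

end FreeGroup

/-! ### Random sampling in multigraphs, and chords of spanning forests -/

section Sampling

/-- The points of `T` all get the colour `0` with probability `Q ^ (-|T|)`; here the denominators
are cleared. -/
theorem card_forall_mem_eq_zero {Z : Type*} [Fintype Z] [DecidableEq Z] (Q : ℕ) [NeZero Q]
    (T : Finset Z) :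
    (Finset.univ.filter fun χ : Z → Fin Q => ∀ z ∈ T, χ z = 0).card * Q ^ T.card =
      Q ^ Fintype.card Z := by
  have h : (Finset.univ.filter fun χ : Z → Fin Q => ∀ z ∈ T, χ z = 0) =
      Fintype.piFinset fun z => if z ∈ T then {0} else Finset.univ := by
    ext χ
    simp only [Finset.mem_filter, Finset.mem_univ, true_and, Fintype.mem_piFinset]
    refine forall_congr' fun z => ?_
    split_ifs with hz <;> simp [hz]
  have h2 : ∀ z, (if z ∈ T then ({0} : Finset (Fin Q)) else Finset.univ).card =
      if z ∈ T then 1 else Q := by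
    intro z; split_ifs <;> simp
  rw [h, Fintype.card_piFinset]
  simp only [h2]
  rw [Finset.prod_ite, Finset.prod_const_one, one_mul, Finset.prod_const, ← pow_add]
  congr 1
  have := Finset.card_filter_add_card_filter_not (s := (Finset.univ : Finset Z)) (fun z => z ∈ T)
  simp only [Finset.filter_univ_mem, Finset.card_univ] at this
  omega

/-- A random set of vertices of a graph spans many edges but few pairs of conflicting edges, if the
number of conflicts is small enough. -/
theorem exists_dense_conflict_free {Z E : Type*} [Fintype Z] [DecidableEq Z] [Fintype E]
    [DecidableEq E] (s t : E → Z) (hst : ∀ e, s e ≠ t e) (conf : Finset (E × E))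
    (hconf : ∀ p ∈ conf, [s p.1, t p.1, s p.2, t p.2].Nodup) {K Q : ℕ}
    (hcard : conf.card + K * Q ^ 3 * Fintype.card Z < Fintype.card E * Q ^ 2) :
    ∃ (S : Finset Z) (D : Finset E), (∀ e ∈ D, s e ∈ S ∧ t e ∈ S) ∧
      (∀ e ∈ D, ∀ e' ∈ D, (e, e') ∉ conf) ∧ K * S.card < D.card := by
  have hQ : NeZero Q := ⟨by rintro rfl; simp at hcard⟩
  let S (χ : Z → Fin Q) : Finset Z := Finset.univ.filter fun z => χ z = 0
  let D (χ : Z → Fin Q) : Finset E := Finset.univ.filter fun e => χ (s e) = 0 ∧ χ (t e) = 0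
  let C (χ : Z → Fin Q) : Finset (E × E) :=
    conf.filter fun p => χ (s p.1) = 0 ∧ χ (t p.1) = 0 ∧ χ (s p.2) = 0 ∧ χ (t p.2) = 0
  -- First moments for a uniform colouring: the means of `|S|`, `|D|`, `|C|` are `|Z| / Q`, `|E| /
  -- Q²`, `|conf| / Q⁴`, the last because the four endpoints of a conflict are distinct. `hcard` is
  -- the resulting inequality of means times `Q⁴`.
  obtain ⟨χ, hχ⟩ : ∃ χ, K * (S χ).card + (C χ).card < (D χ).card := by
    by_contra! h
    have hsum := Finset.sum_le_sum fun χ (_ : χ ∈ (Finset.univ : Finset (Z → Fin Q))) => h χ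
    rw [Finset.sum_add_distrib, ← Finset.mul_sum] at hsum
    have hS : (∑ χ, (S χ).card) * Q = Fintype.card Z * Q ^ Fintype.card Z := by
      rw [show (∑ χ, (S χ).card) = ∑ z, (Finset.univ.filter fun χ : Z → Fin Q => χ z = 0).card from
        Finset.sum_card_bipartiteAbove_eq_sum_card_bipartiteBelow _, Finset.sum_mul]
      rw [Finset.sum_congr rfl fun z _ => ?_, Finset.sum_const, Finset.card_univ, smul_eq_mul]
      simpa using card_forall_mem_eq_zero Q {z}
    have hD : (∑ χ, (D χ).card) * Q ^ 2 = Fintype.card E * Q ^ Fintype.card Z := by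
      rw [show (∑ χ, (D χ).card) =
        ∑ e, (Finset.univ.filter fun χ : Z → Fin Q => χ (s e) = 0 ∧ χ (t e) = 0).card from
        Finset.sum_card_bipartiteAbove_eq_sum_card_bipartiteBelow _, Finset.sum_mul]
      rw [Finset.sum_congr rfl fun e _ => ?_, Finset.sum_const, Finset.card_univ, smul_eq_mul]
      have := card_forall_mem_eq_zero Q {s e, t e}
      rw [Finset.card_pair (hst e)] at this
      simpa using this
    have hC : (∑ χ, (C χ).card) * Q ^ 4 = conf.card * Q ^ Fintype.card Z := by
      rw [show (∑ χ, (C χ).card) =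
        ∑ p ∈ conf, (Finset.univ.filter fun χ : Z → Fin Q => χ (s p.1) = 0 ∧ χ (t p.1) = 0 ∧
          χ (s p.2) = 0 ∧ χ (t p.2) = 0).card from
        Finset.sum_card_bipartiteAbove_eq_sum_card_bipartiteBelow _, Finset.sum_mul]
      rw [Finset.sum_congr rfl fun p hp => ?_, Finset.sum_const, smul_eq_mul]
      have := card_forall_mem_eq_zero Q [s p.1, t p.1, s p.2, t p.2].toFinset
      rw [List.toFinset_card_of_nodup (hconf p hp)] at this
      simpa using this
    have hM : 0 < Q ^ Fintype.card Z := pow_pos (NeZero.pos Q) _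
    have h4 := Nat.mul_le_mul_right (Q ^ 4) hsum
    rw [show (∑ χ, (D χ).card) * Q ^ 4 = ((∑ χ, (D χ).card) * Q ^ 2) * Q ^ 2 by ring, hD,
      add_mul, hC, show K * (∑ χ, (S χ).card) * Q ^ 4 = K * ((∑ χ, (S χ).card) * Q) * Q ^ 3 by ring,
      hS] at h4
    have h5 : Fintype.card E * Q ^ 2 * Q ^ Fintype.card Z ≤
        (conf.card + K * Q ^ 3 * Fintype.card Z) * Q ^ Fintype.card Z := by linarith
    exact absurd (Nat.le_of_mul_le_mul_right h5 hM) (not_le.2 hcard)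
  -- Deleting the first edge of every surviving conflict removes at most `|C|` edges.
  refine ⟨S χ, D χ \ (C χ).image Prod.fst, fun e he => ?_, fun e he e' he' hc => ?_, ?_⟩
  · simpa [S, D] using (Finset.mem_sdiff.1 he).1
  · rw [Finset.mem_sdiff] at he he'
    refine he.2 (Finset.mem_image.2 ⟨(e, e'), ?_, rfl⟩)
    have h1 := he.1
    have h2 := he'.1
    simp only [D, Finset.mem_filter, Finset.mem_univ, true_and] at h1 h2
    simp only [C, Finset.mem_filter]
    exact ⟨hc, h1.1, h1.2, h2.1, h2.2⟩
  · have h1 := Finset.le_card_sdiff ((C χ).image Prod.fst) (D χ)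
    have h2 := Finset.card_image_le (s := C χ) (f := Prod.fst)
    omega

/-- A multigraph with many edges contains a subgraph and a vertex `v` such that many edges outside
of the subgraph have both endpoints in the component of `v` in the subgraph. -/
theorem exists_many_chords {Z E : Type*} [DecidableEq Z] [DecidableEq E] (s t : E → Z)
    (S : Finset Z) (D : Finset E) (hD : ∀ e ∈ D, s e ∈ S ∧ t e ∈ S) {K : ℕ}
    (hcard : (K + 1) * S.card < D.card) :
    ∃ (T : Set E) (v : Z) (f : Fin K → E), T ⊆ D ∧ Function.Injective f ∧
      ∀ k, f k ∈ D ∧ f k ∉ T ∧ Relation.EqvGen (fun a b => ∃ e ∈ T, s e = a ∧ t e = b) v (s (f k)) ∧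
        Relation.EqvGen (fun a b => ∃ e ∈ T, s e = a ∧ t e = b) v (t (f k)) := by
  classical
  let x (e : E) : S → ℚ := fun z => (if t e = z then 1 else 0) - (if s e = z then 1 else 0)
  -- A maximal set of edges with independent boundary vectors is a spanning forest, and has at most
  -- `|S|` edges by dimension.
  obtain ⟨T, hTD, -, hspan, hind⟩ := exists_linearIndepOn_extension
    (linearIndepOn_empty ℚ x) (Set.empty_subset (D : Set E))
  have hTfin : T.Finite := D.finite_toSet.subset hTD
  set r : Z → Z → Prop := fun a b => ∃ e ∈ T, s e = a ∧ t e = b with hr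
  have hconn : ∀ e ∈ D, Relation.EqvGen r (s e) (t e) := by
    intro e he
    -- The sum of the coordinates over the component of `s e` vanishes on the boundaries of the
    -- edges of `T`, hence on that of `e`. This forces `t e` into the same component.
    let L : (S → ℚ) →ₗ[ℚ] ℚ :=
      ∑ z : S, if Relation.EqvGen r (s e) z then LinearMap.proj z else 0
    have hL (y : S → ℚ) : L y = ∑ z : S, if Relation.EqvGen r (s e) z then y z else 0 := by
      rw [LinearMap.sum_apply]
      refine Finset.sum_congr rfl fun z _ => ?_
      split_ifs <;> simp
    have hLx : ∀ e' ∈ D, L (x e') = (if Relation.EqvGen r (s e) (t e') then 1 else 0) -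
        if Relation.EqvGen r (s e) (s e') then 1 else 0 := by
      intro e' he'
      have key : ∀ w ∈ S, (∑ z : S, if Relation.EqvGen r (s e) z then
          (if w = z then (1 : ℚ) else 0) else 0) = if Relation.EqvGen r (s e) w then 1 else 0 := by
        intro w hw
        rw [Finset.sum_eq_single (⟨w, hw⟩ : S)]
        · simp
        · rintro ⟨b, hb⟩ - hne
          have : w ≠ b := fun h => hne (Subtype.ext h.symm)
          simp [this]
        · simp
      rw [hL, ← key _ (hD e' he').1, ← key _ (hD e' he').2, ← Finset.sum_sub_distrib]
      refine Finset.sum_congr rfl fun z _ => ?_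
      split_ifs <;> simp [x, *]
    have h0 : L (x e) = 0 := by
      have hle : Submodule.span ℚ (x '' T) ≤ LinearMap.ker L := by
        rw [Submodule.span_le]
        rintro _ ⟨e', he', rfl⟩
        have h1 : Relation.EqvGen r (s e') (t e') := .rel _ _ ⟨e', he', rfl, rfl⟩
        have h2 : Relation.EqvGen r (s e) (t e') ↔ Relation.EqvGen r (s e) (s e') :=
          ⟨fun h => h.trans _ _ _ h1.symm, fun h => h.trans _ _ _ h1⟩
        simp [hLx e' (hTD he'), h2]
      exact hle (hspan ⟨e, he, rfl⟩)
    rw [hLx e he] at h0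
    by_contra hne
    simp [hne, Relation.EqvGen.refl] at h0
  have hTcard : hTfin.toFinset.card ≤ S.card := by
    have : Fintype T := hTfin.fintype
    have h1 := hind.linearIndependent.fintype_card_le_finrank
    rw [Module.finrank_fintype_fun_eq_card, Fintype.card_coe] at h1
    rwa [← Set.toFinset_card, ← Set.Finite.toFinset_eq_toFinset hTfin] at h1
  let rep (z : Z) : Z := Quotient.out (Quotient.mk (Relation.EqvGen.setoid r) z)
  have hrep (z : Z) : Relation.EqvGen r (rep z) z :=
    Quotient.exact (s := Relation.EqvGen.setoid r) (Quotient.out_eq _)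
  -- Pigeonhole: more than `K * |S|` edges lie outside the forest, in at most `|S|` components.
  obtain ⟨v, -, hv⟩ := Finset.exists_lt_card_fiber_of_mul_lt_card_of_maps_to
    (s := D \ hTfin.toFinset) (t := S.image rep) (f := fun e => rep (s e)) (n := K)
    (fun e he => Finset.mem_image_of_mem _ (hD e (Finset.mem_sdiff.1 he).1).1) (by
      have h1 := Finset.le_card_sdiff hTfin.toFinset D
      have h2 := Finset.card_image_le (s := S) (f := rep)
      have h3 : (S.image rep).card * K ≤ S.card * K := Nat.mul_le_mul_right _ h2
      have h4 : (K + 1) * S.card = S.card * K + S.card := by ring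
      omega)
  set F := (D \ hTfin.toFinset).filter fun e => rep (s e) = v
  obtain ⟨f⟩ : Nonempty (Fin K ↪ F) :=
    Function.Embedding.nonempty_of_card_le (by simpa using hv.le)
  refine ⟨T, v, fun k => (f k : E), hTD, fun a b hab => f.injective (Subtype.ext hab), fun k => ?_⟩
  obtain ⟨hk, hk3⟩ := Finset.mem_filter.1 (f k).2
  rw [Finset.mem_sdiff, Set.Finite.mem_toFinset] at hk
  obtain ⟨hk1, hk2⟩ := hk
  have h1 : Relation.EqvGen r v (s (f k)) := by
    have := hrep (s (f k))
    rwa [hk3] at this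
  exact ⟨hk1, hk2, h1, h1.trans _ _ _ (hconn _ hk1)⟩

end Sampling

namespace FreeGroup

/-! ### Private edges -/

section PrivateEdges

variable {ι G V : Type*} [Group G] [MulAction G V] {φ : FreeGroup ι →* G}

/-- The edge traversed by the letter `l` from the end of the path of the word `w` from `v`. -/
def stepEdge (φ : FreeGroup ι →* G) (v : V) (l : ι × Bool) (w : List (ι × Bool)) : ι × V :=
  (l.1, if l.2 then φ (mk w) • v else φ (mk (l :: w)) • v)

/-- The path of the word `w` from `v` traverses the edge `e` exactly once. -/
def TraversesOnce (φ : FreeGroup ι →* G) (v : V) (w : List (ι × Bool)) (e : ι × V) : Prop :=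
  ∃ P l Q, w = P ++ l :: Q ∧ e = stepEdge φ v l Q ∧
    e ∉ edges φ (φ (mk (l :: Q)) • v) P ∧ e ∉ edges φ v Q

/-- The elements `α k` have words such that the path from `v` of each of them traverses
exactly once an edge that is not traversed by the others. -/
def HavePrivateEdges (φ : FreeGroup ι →* G) (v : V) {κ : Type*} (α : κ → FreeGroup ι) : Prop :=
  ∃ (w : κ → List (ι × Bool)) (e : κ → ι × V), (∀ k, mk (w k) = α k) ∧
    (∀ k, TraversesOnce φ v (w k) (e k)) ∧ ∀ k k', k' ≠ k → e k ∉ edges φ v (w k')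

theorem TraversesOnce.mem {v : V} {w : List (ι × Bool)} {e : ι × V}
    (h : TraversesOnce φ v w e) : e ∈ edges φ v w := by
  obtain ⟨P, l, Q, rfl, rfl, -, -⟩ := h
  rw [edges_append, edges_cons]
  exact List.mem_append_right _ List.mem_cons_self

theorem TraversesOnce.of_append {v : V} {A w B : List (ι × Bool)} {e : ι × V}
    (h : TraversesOnce φ (φ (mk B) • v) w e) (hA : e ∉ edges φ (φ (mk (w ++ B)) • v) A)
    (hB : e ∉ edges φ v B) : TraversesOnce φ v (A ++ w ++ B) e := by
  obtain ⟨P, l, Q, rfl, rfl, h1, h2⟩ := h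
  refine ⟨A ++ P, l, Q ++ B, by simp, ?_, ?_, ?_⟩
  · simp only [stepEdge, mk_append_smul, ← List.cons_append]
  · rw [edges_append, List.mem_append, not_or]
    constructor
    · rw [← mk_append_smul]
      simpa using hA
    · rwa [← List.cons_append, mk_append_smul]
  · rw [edges_append, List.mem_append, not_or]
    exact ⟨h2, hB⟩

theorem TraversesOnce.of_nodup {v : V} {P Q : List (ι × Bool)} {l : ι × Bool}
    (h : (edges φ v (P ++ l :: Q)).Nodup) : TraversesOnce φ v (P ++ l :: Q) (stepEdge φ v l Q) := by
  refine ⟨P, l, Q, rfl, rfl, fun hP => ?_, fun hQ => ?_⟩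
  · rw [edges_append] at h
    exact List.disjoint_of_nodup_append h hP List.mem_cons_self
  · rw [edges_append] at h
    exact (List.nodup_cons.1 (List.nodup_append.1 h).2.1).1 hQ

/-- Private edges survive a conjugation after which a few of the elements are dropped. -/
theorem exists_conj_havePrivateEdges {v : V} (p : List (ι × Bool)) {K : ℕ}
    {α : Fin (K + p.length) → FreeGroup ι} (hα : HavePrivateEdges φ v α)
    (hv : ∀ k, φ (α k) • v = v) :
    ∃ f : Fin K → Fin (K + p.length),
      HavePrivateEdges φ (φ (mk p) • v) fun k => mk p * α (f k) * (mk p)⁻¹ := by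
  classical
  obtain ⟨w, e, hw, he, he'⟩ := hα
  have hinj : Function.Injective e := by
    intro a b hab
    by_contra hne
    exact he' a b (Ne.symm hne) (hab ▸ (he b).mem)
  -- The private edges are distinct, so at most `p.length` of them lie on the path of `p`. Dropping
  -- the corresponding elements leaves `K`.
  set B : Finset (Fin (K + p.length)) := Finset.univ.filter fun k => e k ∈ edges φ v p with hB
  have hBcard : B.card ≤ p.length := by
    refine le_trans ?_ ((List.toFinset_card_le _).trans_eq (length_edges (φ := φ) v p))
    refine Finset.card_le_card_of_injOn e (fun k hk => ?_) hinj.injOn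
    simpa [hB] using hk
  have hBc : K ≤ Bᶜ.card := by
    rw [Finset.card_compl, Fintype.card_fin]; omega
  obtain ⟨f⟩ : Nonempty (Fin K ↪ (Bᶜ : Finset _)) :=
    Function.Embedding.nonempty_of_card_le (by rwa [Fintype.card_fin, Fintype.card_coe])
  have hf (k : Fin K) : e (f k) ∉ edges φ v p := by
    have := (f k).2
    simpa [hB] using this
  have hend (k : Fin (K + p.length)) : φ (mk (w k)) • v = v := by rw [hw, hv]
  have hback : φ (mk (invRev p)) • φ (mk p) • v = v := by
    rw [← inv_mk, _root_.map_inv, inv_smul_smul]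
  refine ⟨fun k => f k, fun k => p ++ w (f k) ++ invRev p, fun k => e (f k), fun k => ?_,
    fun k => ?_, fun k k' hk => ?_⟩
  · rw [← mul_mk, ← mul_mk, hw, inv_mk]
  · refine TraversesOnce.of_append ?_ ?_ ?_
    · rw [hback]; exact he _
    · rw [mk_append_smul, hback, hend]; exact hf k
    · rw [mem_edges_invRev]; exact hf k
  · simp only [edges_append, List.mem_append, not_or, hback, hend, mem_edges_invRev]
    exact ⟨⟨hf k, he' _ _ fun h => hk (f.injective (Subtype.ext h))⟩, hf k⟩

end PrivateEdges

/-! ### Loops with private edges in finite orbits -/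

section PrivateLoops

variable {ι G V : Type*} [Group G] [MulAction G V] {φ : FreeGroup ι →* G}

theorem FreeUpTo.mk_eq {R : ℕ} {v : V} (h : FreeUpTo φ R v) {A B : List (ι × Bool)}
    (hR : A.length + B.length ≤ R) (hAB : φ (mk A) • v = φ (mk B) • v) : mk A = mk B := by
  have h1 : mk (invRev B ++ A) = 1 := by
    refine h.eq_one (x := 1) (by simp; omega) ?_
    rw [_root_.map_one, one_smul, mk_append_smul, hAB, ← inv_mk, _root_.map_inv, inv_smul_smul]
  rw [← mul_mk, ← inv_mk] at h1
  exact (inv_mul_eq_one.1 h1).symm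

theorem ReducedFromTo.ne_nil {s t : ι × Bool} {w : List (ι × Bool)} (h : ReducedFromTo s t w) :
    w ≠ [] := by
  rintro rfl
  simpa using h.head

/-- If the path of the square of `b` from `z'` traverses the middle edge of the path of the square
of `a = l :: a'` from `z`, then the endpoints of the two paths are four different vertices. -/
theorem FreeUpTo.conflict {s t : ι × Bool} (hst : t.1 = s.1 → t.2 = s.2) {a a' b : List (ι × Bool)}
    {l : ι × Bool} {n : ℕ} (hn : 2 ≤ n) (ha : ReducedFromTo s t a) (hb : ReducedFromTo s t b)
    (han : a.length = n) (hbn : b.length = n) (hal : a = l :: a') {z z' : V}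
    (hz : FreeUpTo φ (5 * n) z) (hne : ¬ (a = b ∧ z = z'))
    (hmem : stepEdge φ z l a' ∈ edges φ z' (b ++ b)) :
    (∃ k ≤ 2 * n, φ (mk a') • z = φ (mk ((b ++ b).drop k)) • z') ∧
      [z, φ (mk (a ++ a)) • z, z', φ (mk (b ++ b)) • z'].Nodup := by
  have hbb := hb.append hst hb
  have haa := ha.append hst ha
  have haa' : a ++ a = (a ++ [l]) ++ a' := by nth_rw 2 [hal]; simp
  have ha'n : a'.length + 1 = n := by rw [← han, hal]; rfl
  have hlab (P' Q' : List (ι × Bool)) : P' ++ Q' = b ++ b → P'.length + Q'.length = 2 * n := by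
    intro h
    have := congrArg List.length h
    simp only [List.length_append] at this
    omega
  -- Split the path of `b ++ b` where it visits the endpoint `a' • z` of the marked edge. The edge
  -- is either about to be traversed forwards, so that `l` ends `P'`, or was just traversed
  -- backwards, so that the inverse of `l` begins `Q'`.
  obtain ⟨P', Q', hPQ, hzz, hdir⟩ : ∃ P' Q', P' ++ Q' = b ++ b ∧
      φ (mk a') • z = φ (mk Q') • z' ∧
      ((∃ P, P' = P ++ [l]) ∨ ∃ Q, Q' = (l.1, !l.2) :: Q) := by
    obtain ⟨P, l', Q, hPQ, he⟩ := exists_of_mem_edges hmem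
    rcases step_eq_iff he with ⟨rfl, h⟩ | ⟨rfl, h⟩
    · exact ⟨P ++ [l], Q, by simp [hPQ], h, .inl ⟨P, rfl⟩⟩
    · exact ⟨P, (l.1, !l.2) :: Q, hPQ.symm, h, .inr ⟨Q, rfl⟩⟩
  have hlen := hlab _ _ hPQ
  have hPr : IsReduced P' := (hPQ ▸ hbb.1).left
  have hQr : IsReduced Q' := (hPQ ▸ hbb.1).right
  have ha'r : IsReduced a' := by
    have := ha.1
    rw [hal, ← List.singleton_append] at this
    exact this.right
  have hxz' : φ (mk (b ++ b)) • z' = φ (mk (P' ++ a')) • z := by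
    rw [← hPQ, mk_append_smul, ← hzz, ← mk_append_smul]
  have hnotrev (A B : List (ι × Bool)) : ¬ IsReduced (A ++ l :: (l.1, !l.2) :: B) := by
    intro h
    have h1 := (isReduced_cons_cons.1 h.right).1 rfl
    simp at h1
  have ends_ne : ∀ w : List (ι × Bool), ReducedFromTo s t w → w.length = n →
      ∀ y : V, FreeUpTo φ (5 * n) y → φ (mk (w ++ w)) • y ≠ y := by
    intro w hw hwn y hy
    simpa using hy (w ++ w) (hw.append hst hw).1 (by simpa using hw.ne_nil) (by simp; omega) 1
  have hz'eq : z' = φ (mk (invRev Q' ++ a')) • z := by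
    rw [mk_append_smul, hzz, ← inv_mk, _root_.map_inv, inv_smul_smul]
  have hz' : FreeUpTo φ (5 * n) z' := by
    rw [hz'eq]; exact hz.smul _
  -- Every further coincidence of endpoints gives a relation of total length less than `5 * n`,
  -- which must hold in the free group. It then either exhibits a nonempty reduced word that is
  -- trivial, or makes two reduced words equal, which forces a cancellation or `a = b` and `z = z'`.
  -- The square provides a full copy of `a` on either side of its midpoint, so that `a` can be
  -- recognized from either half.
  have h12 := (ends_ne a ha han z hz).symm
  have h34 := (ends_ne b hb hbn z' hz').symm
  have eq_of_Q : a' = Q' → a = b ∧ z = z' := by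
    intro hQ
    refine ⟨?_, ?_⟩
    · rcases hdir with ⟨P, rfl⟩ | ⟨Q, rfl⟩
      · have h1 : P ++ a = b ++ b := by rw [← hPQ, hal, hQ]; simp
        exact (List.append_inj' h1 (by omega)).2
      · have := ha.1
        rw [hal, hQ] at this
        exact absurd this (hnotrev [] Q)
    · rw [hQ] at hzz
      exact smul_left_cancel _ hzz
  have h13 : z ≠ z' := by
    rintro rfl
    have h1 := ha'r.eq_of_mk_eq hQr (hz.mk_eq (by omega) hzz)
    exact hne (eq_of_Q h1)
  have h24 : φ (mk (a ++ a)) • z ≠ φ (mk (b ++ b)) • z' := by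
    intro h
    rw [hxz'] at h
    have h1 := hz.mk_eq (by simp only [List.length_append]; omega) h
    have h2 : mk (a ++ [l]) = mk P' := by
      rw [haa', ← mul_mk, ← mul_mk (L₁ := P')] at h1
      exact mul_right_cancel h1
    have h3 : a ++ [l] = P' := by
      refine IsReduced.eq_of_mk_eq ?_ hPr h2
      have := haa.1
      rw [haa'] at this
      exact this.left
    rcases hdir with ⟨P, rfl⟩ | ⟨Q, rfl⟩
    · have h4 := List.append_inj_left' h3 rfl
      subst h4
      rw [List.append_assoc] at hPQ
      have h5 := List.append_inj hPQ (by omega)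
      apply hne
      refine ⟨h5.1, ?_⟩
      refine (eq_of_Q ?_).2
      have h6 := h5.2
      rw [← h5.1] at h6
      rw [hal] at h6
      simpa using h6.symm
    · have := hbb.1
      rw [← hPQ, ← h3] at this
      refine hnotrev a Q ?_
      simpa using this
  have h23 : φ (mk (a ++ a)) • z ≠ z' := by
    intro h
    rw [← h, ← mk_append_smul] at hzz
    have h1 := hz.mk_eq (by simp only [List.length_append]; omega) hzz
    have h2 : mk (Q' ++ (a ++ [l])) = 1 := by
      have h3 : Q' ++ (a ++ a) = Q' ++ (a ++ [l]) ++ a' := by simp [haa']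
      rw [h3, ← mul_mk] at h1
      exact mul_eq_right.1 h1.symm
    refine IsReduced.mk_ne_one ?_ (by simp) h2
    have h4 := ((hbb.append hst ha).append hst ha).1
    rw [← hPQ] at h4
    refine h4.infix ⟨P', a', ?_⟩
    nth_rw 3 [hal]
    simp
  have h14 : z ≠ φ (mk (b ++ b)) • z' := by
    intro h
    rw [hxz'] at h
    have h1 : mk ([] : List (ι × Bool)) = mk (P' ++ a') := by
      refine hz.mk_eq (by simp only [List.length_append, List.length_nil]; omega) ?_
      rw [← h, ← one_eq_mk, _root_.map_one, one_smul]
    have h2 : mk (a' ++ P') = 1 := by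
      rw [← mul_mk] at h1 ⊢
      exact mul_eq_one_iff_eq_inv'.2 (mul_eq_one_iff_eq_inv.1 h1.symm) |> fun h => by
        simpa using h
    refine IsReduced.mk_ne_one ?_ ?_ h2
    · have h4 := (ha.append hst hbb).1
      rw [← hPQ] at h4
      refine h4.infix ⟨[l], Q', ?_⟩
      rw [hal]; simp
    · intro h0
      have := congrArg List.length h0
      simp at this
      have h1 := this.1
      rw [h1] at ha'n
      simp at ha'n
      omega
  refine ⟨⟨P'.length, by omega, ?_⟩, ?_⟩
  · rw [← hPQ, List.drop_left]; exact hzz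
  · simp only [List.nodup_cons, List.mem_cons, List.not_mem_nil, or_false, not_or,
      not_false_eq_true, List.nodup_nil, and_true]
    exact ⟨⟨h12, h13, h14⟩, ⟨h23, h24⟩, h34⟩

/-- The multigraph on the orbit `Z` has an edge `e = (i, z)` from `z` to `c i ^ 2 • z`, marked by
the edge `μ e` of the Schreier graph in the middle of its path. A conflict is a marked edge on the
path of another edge of the multigraph; without conflicts, a chord of a forest keeps its mark
private in the loop that it closes. -/
theorem exists_private_loops_of_code {Γ : Subgroup (FreeGroup ι)} {s t : ι × Bool}
    (hst : t.1 = s.1 → t.2 = s.2) {n K Q q : ℕ} (hn : 2 ≤ n)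
    (hq : q = (K + 2) * Q) (hQ : (K + 2) ^ 2 * (2 * n + 1) < Q) {c : Fin q → List (ι × Bool)}
    (hinj : Function.Injective c)
    (hc : ∀ i, (c i).length = n ∧ ReducedFromTo s t (c i) ∧ mk (c i) ∈ Γ) {u : V}
    (hu : FreeUpTo φ (5 * n) u) (hfin : {z | ∃ x ∈ Γ, φ x • u = z}.Finite) :
    ∃ y ∈ Γ, ∃ α : Fin K → FreeGroup ι, (∀ k, α k ∈ Γ ∧ φ (α k) • φ y • u = φ y • u) ∧
      HavePrivateEdges φ (φ y • u) α := by
  classical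
  let Z := {z | ∃ x ∈ Γ, φ x • u = z}
  have : Fintype Z := hfin.fintype
  have hZ0 : 0 < Fintype.card Z :=
    Fintype.card_pos_iff.2 ⟨⟨u, 1, one_mem _, by simp⟩⟩
  have hl : ∀ i, ∃ l c', c i = l :: c' := fun i => List.exists_cons_of_ne_nil (hc i).2.1.ne_nil
  choose l c' hlc using hl
  have hccΓ (i : Fin q) : mk (c i ++ c i) ∈ Γ := by
    rw [← mul_mk]; exact mul_mem (hc i).2.2 (hc i).2.2
  have hcc (i : Fin q) : c i ++ c i = c i ++ l i :: c' i := by rw [← hlc]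
  let X (e : Fin q × Z) : Z := ⟨φ (mk (c e.1 ++ c e.1)) • (e.2 : V), by
    obtain ⟨x, hx, hxe⟩ := e.2.2
    exact ⟨mk (c e.1 ++ c e.1) * x, mul_mem (hccΓ _) hx, by
      rw [_root_.map_mul, mul_smul, hxe]⟩⟩
  let μ (e : Fin q × Z) : ι × V := stepEdge φ (e.2 : V) (l e.1) (c' e.1)
  have hfree (z : Z) : FreeUpTo φ (5 * n) (z : V) := by
    obtain ⟨x, -, hx⟩ := z.2
    rw [← hx]
    exact hu.smul x
  let conf : Finset ((Fin q × Z) × (Fin q × Z)) := Finset.univ.filter fun p =>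
    p.1 ≠ p.2 ∧ μ p.1 ∈ edges φ (p.2.2 : V) (c p.2.1 ++ c p.2.1)
  have hconf : ∀ p ∈ conf, (∃ k ≤ 2 * n, φ (mk (c' p.1.1)) • (p.1.2 : V) =
      φ (mk ((c p.2.1 ++ c p.2.1).drop k)) • (p.2.2 : V)) ∧
      [(p.1.2 : V), X p.1, p.2.2, X p.2].Nodup := by
    intro p hp
    simp only [conf, Finset.mem_filter, Finset.mem_univ, true_and] at hp
    refine (hfree p.1.2).conflict hst hn (hc _).2.1 (hc _).2.1 (hc _).1 (hc _).1 (hlc _) ?_ hp.2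
    rintro ⟨h1, h2⟩
    exact hp.1 (Prod.ext (hinj h1) (Subtype.ext h2))
  -- A conflict is determined by its first edge, the code word of the second one, and the position
  -- `k` at which the second path meets the marked edge: these recover the starting point of the
  -- second path.
  have hcard : conf.card ≤ (q * Fintype.card Z) * (q * (2 * n + 1)) := by
    have hk : ∀ p : (Fin q × Z) × (Fin q × Z), ∃ k : Fin (2 * n + 1), p ∈ conf →
        φ (mk (c' p.1.1)) • (p.1.2 : V) =
          φ (mk ((c p.2.1 ++ c p.2.1).drop k)) • (p.2.2 : V) := by
      intro p
      by_cases hp : p ∈ conf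
      · obtain ⟨k, hk, h⟩ := (hconf p hp).1
        exact ⟨⟨k, by omega⟩, fun _ => h⟩
      · exact ⟨0, fun h => absurd h hp⟩
    choose k hk using hk
    have h1 := Finset.card_le_card_of_injOn (s := conf)
      (t := (Finset.univ : Finset ((Fin q × Z) × (Fin q × Fin (2 * n + 1)))))
      (fun p => (p.1, p.2.1, k p)) (fun _ _ => Finset.mem_univ _) (by
        rintro ⟨e, j, z⟩ hp ⟨e', j', z'⟩ hp' h
        simp only [Prod.mk.injEq] at h
        obtain ⟨rfl, rfl, h3⟩ := h
        have h4 := hk _ hp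
        have h5 := hk _ hp'
        rw [← h3, h4] at h5
        have h6 : z = z' := Subtype.ext (smul_left_cancel _ h5)
        rw [h6])
    simpa using h1
  -- The hypothesis on `Q` bounds the conflicts by `Q³ * |Z|`. Since `|E| * Q² = (K + 2) * Q³ *
  -- |Z|`, the density `K + 1` is left, of which the forest takes `1`.
  obtain ⟨S, D, hDS, hD, hDcard⟩ := exists_dense_conflict_free (fun e : Fin q × Z => e.2) X
    (fun e h => by
      have h1 := congrArg Subtype.val h
      refine hfree e.2 (c e.1 ++ c e.1) ((hc _).2.1.append hst (hc _).2.1).1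
        (by simpa using (hc _).2.1.ne_nil) ?_ 1 ?_
      · simp only [List.length_append, (hc _).1]; omega
      · simpa using h1.symm) conf (K := K + 1) (Q := Q)
    (fun p hp => List.Nodup.of_map Subtype.val (by simpa using (hconf p hp).2)) (by
      have h1 : (q * Fintype.card Z) * (q * (2 * n + 1)) =
          ((K + 2) ^ 2 * (2 * n + 1)) * (Q ^ 2 * Fintype.card Z) := by rw [hq]; ring
      have hQ0 : 0 < Q := by omega
      have h5 := Nat.mul_lt_mul_of_pos_right hQ (show 0 < Q ^ 2 * Fintype.card Z by positivity)
      calc conf.card + (K + 1) * Q ^ 3 * Fintype.card Z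
          < Q * (Q ^ 2 * Fintype.card Z) + (K + 1) * Q ^ 3 * Fintype.card Z :=
            Nat.add_lt_add_right ((hcard.trans_eq h1).trans_lt h5) _
        _ = Fintype.card (Fin q × Z) * Q ^ 2 := by
            rw [Fintype.card_prod, Fintype.card_fin, hq]; ring)
  obtain ⟨T, v, f, hTD, hf, hfk⟩ := exists_many_chords (fun e : Fin q × Z => e.2) X S D hDS hDcard
  -- Connections in the forest are realized by words of `Γ` whose paths avoid the marks of all
  -- chords.
  have hpath : ∀ a b : Z, Relation.EqvGen (fun a b => ∃ e ∈ T, e.2 = a ∧ X e = b) a b →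
      ∃ w, mk w ∈ Γ ∧ φ (mk w) • (a : V) = b ∧
        ∀ e ∈ D, e ∉ T → μ e ∉ edges φ (a : V) w := by
    intro a b hab
    induction hab with
    | rel a b h =>
      obtain ⟨e, heT, rfl, rfl⟩ := h
      refine ⟨c e.1 ++ c e.1, hccΓ _, rfl, fun e' he' he'T hmem => ?_⟩
      refine hD e' he' e (hTD heT) ?_
      simp only [conf, Finset.mem_filter, Finset.mem_univ, true_and]
      exact ⟨fun h => he'T (h ▸ heT), hmem⟩
    | refl a => exact ⟨[], one_mem _, by simp [← one_eq_mk], fun _ _ _ => by simp⟩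
    | symm a b _ ih =>
      obtain ⟨w, h1, h2, h3⟩ := ih
      refine ⟨invRev w, by rw [← inv_mk]; exact inv_mem h1, ?_, fun e he heT => ?_⟩
      · rw [← inv_mk, _root_.map_inv, inv_smul_eq_iff, h2]
      · rw [← h2, mem_edges_invRev]
        exact h3 e he heT
    | trans a b c _ _ ih ih' =>
      obtain ⟨w, h1, h2, h3⟩ := ih
      obtain ⟨w', h1', h2', h3'⟩ := ih'
      refine ⟨w' ++ w, by rw [← mul_mk]; exact mul_mem h1' h1, by rw [mk_append_smul, h2, h2'],
        fun e he heT => ?_⟩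
      rw [edges_append, List.mem_append, not_or, h2]
      exact ⟨h3' e he heT, h3 e he heT⟩
  choose ws hws using fun k => hpath _ _ (hfk k).2.2.1
  choose wt hwt using fun k => hpath _ _ (hfk k).2.2.2
  obtain ⟨y, hy, hyv⟩ := v.2
  -- Each loop runs through the forest to the start of a chord, along the chord, and back through
  -- the forest.
  refine ⟨y, hy, fun k => mk (invRev (wt k) ++ (c (f k).1 ++ c (f k).1) ++ ws k), fun k => ⟨?_, ?_⟩,
    fun k => invRev (wt k) ++ (c (f k).1 ++ c (f k).1) ++ ws k, fun k => μ (f k), fun k => rfl,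
    fun k => ?_, fun k k' hk => ?_⟩
  · simp only [← mul_mk (L₂ := ws k), ← mul_mk (L₁ := invRev (wt k)), ← inv_mk]
    exact mul_mem (mul_mem (inv_mem (hwt k).1) (hccΓ _)) (hws k).1
  · rw [hyv, mk_append_smul, (hws k).2.1, mk_append_smul, ← inv_mk, _root_.map_inv, inv_smul_eq_iff,
      (hwt k).2.1]
  · rw [hyv]
    have hX : φ (mk (c (f k).1 ++ c (f k).1)) • ((f k).2 : V) = φ (mk (wt k)) • (v : V) :=
      (hwt k).2.1.symm
    refine TraversesOnce.of_append ?_ ?_ ((hws k).2.2 _ (hfk k).1 (hfk k).2.1)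
    · rw [(hws k).2.1, hcc]
      apply TraversesOnce.of_nodup
      rw [← hcc]
      refine (hfree (f k).2).nodup_edges ((hc _).2.1.append hst (hc _).2.1).1 ?_
      simp only [List.length_append, (hc _).1]; omega
    · rw [mk_append_smul, (hws k).2.1, hX, mem_edges_invRev]
      exact (hwt k).2.2 _ (hfk k).1 (hfk k).2.1
  · rw [hyv]
    have hX : φ (mk (c (f k').1 ++ c (f k').1)) • ((f k').2 : V) = φ (mk (wt k')) • (v : V) :=
      (hwt k').2.1.symm
    rw [edges_append, List.mem_append, edges_append, List.mem_append, (hws k').2.1, hX,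
      mem_edges_invRev, not_or, not_or]
    refine ⟨⟨(hwt k').2.2 _ (hfk k).1 (hfk k).2.1, fun hmem => ?_⟩,
      (hws k').2.2 _ (hfk k).1 (hfk k).2.1⟩
    refine hD (f k) (hfk k).1 (f k') (hfk k').1 ?_
    simp only [conf, Finset.mem_filter, Finset.mem_univ, true_and]
    exact ⟨fun h => hk (hf h).symm, hmem⟩

/-- Every finite orbit of a non-cyclic subgroup, around which the Schreier graph has no short loops,
has a point with many elements in its stabilizer that have private edges. -/
theorem exists_private_loops [Finite ι] {Δ : Subgroup (FreeGroup ι)} (hΔ : ¬ IsCyclic Δ) (K : ℕ) :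
    ∃ R : ℕ, ∀ (φ : FreeGroup ι →* G) (u : V), FreeUpTo φ R u →
      (MulAction.orbit (Δ.map φ) u).Finite →
      ∃ v ∈ MulAction.orbit (Δ.map φ) u, ∃ α : Fin K → FreeGroup ι,
        (∀ k, α k ∈ Δ ∧ φ (α k) • v = v) ∧ HavePrivateEdges φ v α := by
  obtain ⟨p, s, t, hst, hcode⟩ := exists_code_of_not_isCyclic hΔ
  -- The final conjugation by `p` may spoil up to `p.length` loops. The multiplier passed to `hcode`
  -- ensures `(M + 2) * Q` code words, although `Q` grows linearly with their length `n`.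
  set M := K + p.length with hM
  obtain ⟨n, hn, hcn⟩ := hcode ((M + 2) * (2 * (M + 2) ^ 2 + 1))
  set Q := (M + 2) ^ 2 * (2 * n + 1) + 1 with hQ
  obtain ⟨c, hinj, hc⟩ := hcn ((M + 2) * Q) (by
    rw [mul_assoc]
    refine Nat.mul_le_mul_left _ ?_
    rw [hQ]
    nlinarith [sq_nonneg (M + 2)])
  refine ⟨5 * n, fun φ u hu hfin => ?_⟩
  set Γ : Subgroup (FreeGroup ι) := Δ.map (MulAut.conj (mk p)⁻¹).toMonoidHom with hΓ
  have hmem (x : FreeGroup ι) : x ∈ Γ ↔ mk p * x * (mk p)⁻¹ ∈ Δ := by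
    rw [hΓ, Subgroup.mem_map]
    constructor
    · rintro ⟨y, hy, rfl⟩
      rw [MulEquiv.coe_toMonoidHom, MulAut.conj_apply]
      convert hy using 1
      group
    · intro h
      refine ⟨_, h, ?_⟩
      rw [MulEquiv.coe_toMonoidHom, MulAut.conj_apply]
      group
  set u' := φ (mk p)⁻¹ • u with hu'
  have hpu' : φ (mk p) • u' = u := by rw [hu', _root_.map_inv, smul_inv_smul]
  have horb (x : FreeGroup ι) (hx : x ∈ Γ) :
      φ (mk p) • φ x • u' ∈ MulAction.orbit (Δ.map φ) u := by
    refine ⟨⟨φ (mk p * x * (mk p)⁻¹), Subgroup.mem_map_of_mem φ ((hmem x).1 hx)⟩, ?_⟩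
    change φ (mk p * x * (mk p)⁻¹) • u = _
    rw [_root_.map_mul, _root_.map_mul, mul_smul, mul_smul]
  obtain ⟨y, hy, α, hα, hpriv⟩ := exists_private_loops_of_code (Γ := Γ) (u := u') hst hn
    rfl (Nat.lt_succ_self _) hinj (fun i => ⟨(hc i).1, (hc i).2.1, (hmem _).2 (hc i).2.2⟩)
    (hu.smul _) (by
      refine Set.Finite.of_finite_image (f := fun z => φ (mk p) • z) (hfin.subset ?_)
        (MulAction.injective _).injOn
      rintro _ ⟨_, ⟨x, hx, rfl⟩, rfl⟩
      exact horb x hx)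
  obtain ⟨f, hf⟩ := exists_conj_havePrivateEdges p hpriv fun k => (hα k).2
  refine ⟨φ (mk p) • φ y • u', horb y hy, _, fun k => ⟨(hmem _).1 (hα (f k)).1, ?_⟩, hf⟩
  rw [← mul_smul, ← _root_.map_mul, inv_mul_cancel_right, _root_.map_mul, mul_smul, (hα _).2]

end PrivateLoops

end FreeGroup

namespace IteratedWreath

open Filter Topology

variable {d : ℕ} {H : Subgroup (Equiv.Perm (Fin d))}

/-! ### Automorphisms with prescribed sections -/

section Construction

theorem smul_nil (g : W H) : g • ([] : Vertex d) = [] :=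
  List.eq_nil_of_length_eq_zero (length_smul g [])

theorem ext_smul {g h : W H} (hgh : ∀ v : Vertex d, g • v = h • v) : g = h :=
  Subtype.ext (Equiv.ext hgh)

theorem take_smul (g : W H) (n : ℕ) (v : Vertex d) : (g • v).take n = g • v.take n := by
  rcases le_or_gt v.length n with h | h
  · rw [List.take_of_length_le h, List.take_of_length_le (by rwa [length_smul])]
  · nth_rw 1 [← List.take_append_drop n v, smul_append_eq,
      ← List.length_take_of_le h.le, ← length_smul g (v.take n), List.take_left]

theorem β_smul_eq_iff (g : W H) (v w x : Vertex d) :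
    β g v • w = x ↔ g • (v ++ w) = g • v ++ x := secFun_eq_iff g v w x

/-- The automorphism of the tree that fixes the level `n` pointwise and acts as `c u` on the subtree
below the vertex `u` of that level. -/
def levelInsFun (n : ℕ) (c : Vertex d → W H) (v : Vertex d) : Vertex d :=
  v.take n ++ c (v.take n) • v.drop n

theorem take_levelInsFun (n : ℕ) (c : Vertex d → W H) (v : Vertex d) :
    (levelInsFun n c v).take n = v.take n := by
  rw [levelInsFun]
  rcases le_or_gt n v.length with h | h
  · nth_rw 1 [← List.length_take_of_le h]
    exact List.take_left
  · rw [List.drop_of_length_le h.le, smul_nil, List.append_nil, List.take_take, min_self]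

theorem drop_levelInsFun (n : ℕ) (c : Vertex d → W H) (v : Vertex d) :
    (levelInsFun n c v).drop n = c (v.take n) • v.drop n := by
  rw [levelInsFun]
  rcases le_or_gt n v.length with h | h
  · nth_rw 1 [← List.length_take_of_le h]
    exact List.drop_left
  · rw [List.drop_of_length_le h.le, smul_nil, List.append_nil]
    simp

theorem levelInsFun_levelInsFun (n : ℕ) (c c' : Vertex d → W H) (v : Vertex d) :
    levelInsFun n c (levelInsFun n c' v) = levelInsFun n (fun u => c u * c' u) v := by
  conv_lhs => rw [levelInsFun]
  rw [take_levelInsFun, drop_levelInsFun, ← mul_smul]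
  rfl

theorem levelInsFun_one (n : ℕ) (v : Vertex d) :
    levelInsFun n (fun _ => (1 : W H)) v = v := by
  simp [levelInsFun]

theorem levelInsFun_prefix (n : ℕ) (c : Vertex d → W H) {v w : Vertex d} (h : v <+: w) :
    levelInsFun n c v <+: levelInsFun n c w := by
  obtain ⟨x, rfl⟩ := h
  rcases le_or_gt n v.length with h | h
  · rw [levelInsFun, levelInsFun, List.take_append_of_le_length h,
      List.drop_append_of_le_length h, smul_append_eq, ← List.append_assoc]
    exact List.prefix_append _ _
  · rw [levelInsFun, List.drop_of_length_le h.le, smul_nil, List.append_nil,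
      List.take_of_length_le h.le]
    have h1 : v <+: (levelInsFun n c (v ++ x)).take n := by
      rw [take_levelInsFun]
      refine List.prefix_take_iff.2 ⟨List.prefix_append _ _, h.le⟩
    exact h1.trans (List.take_prefix _ _)

/-- The automorphism `levelInsFun n c` as an element of `W(H)`. -/
def levelIns (n : ℕ) (c : Vertex d → W H) : W H :=
  ⟨{ toFun := levelInsFun n c
     invFun := levelInsFun n fun u => (c u)⁻¹
     left_inv := fun v => by rw [levelInsFun_levelInsFun]; simp [levelInsFun_one]
     right_inv := fun v => by rw [levelInsFun_levelInsFun]; simp [levelInsFun_one] }, by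
    refine ⟨⟨fun v => ?_, fun v w => ⟨fun h => ?_, levelInsFun_prefix n c⟩⟩, fun v => ?_⟩
    · change (v.take n ++ c (v.take n) • v.drop n).length = _
      rw [List.length_append, length_smul, ← List.length_append, List.take_append_drop]
    · have h1 := levelInsFun_prefix n (fun u => (c u)⁻¹) h
      change levelInsFun n _ (levelInsFun n c v) <+: levelInsFun n _ (levelInsFun n c w) at h1
      simpa [levelInsFun_levelInsFun, levelInsFun_one] using h1
    · change ∃ h ∈ H, ∀ i, levelInsFun n c (v ++ [i]) = levelInsFun n c v ++ [h i]
      rcases le_or_gt n v.length with h | h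
      · obtain ⟨σ, hσ, hi⟩ := (c (v.take n)).2.2 (v.drop n)
        refine ⟨σ, hσ, fun i => ?_⟩
        have := hi i
        rw [← smul_def, ← smul_def] at this
        rw [levelInsFun, levelInsFun, List.take_append_of_le_length h,
          List.drop_append_of_le_length h, this, List.append_assoc]
      · refine ⟨1, one_mem _, fun i => ?_⟩
        have h1 : v.length + 1 ≤ n := h
        simp [levelInsFun, List.take_of_length_le, List.drop_of_length_le, h.le, h1, smul_nil]⟩

theorem levelIns_smul (n : ℕ) (c : Vertex d → W H) (v : Vertex d) :
    levelIns n c • v = v.take n ++ c (v.take n) • v.drop n := rfl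

theorem levelIns_smul_of_length {n : ℕ} (c : Vertex d → W H) {v : Vertex d} (hv : v.length ≤ n) :
    levelIns n c • v = v := by
  rw [levelIns_smul, List.drop_of_length_le hv, smul_nil, List.append_nil,
    List.take_of_length_le hv]

theorem β_levelIns {n : ℕ} (c : Vertex d → W H) {v : Vertex d} (hv : v.length = n) :
    β (levelIns n c) v = c v := by
  refine ext_smul fun w => ?_
  rw [β_smul_eq_iff, levelIns_smul_of_length c hv.le, levelIns_smul]
  subst hv
  rw [List.take_left, List.drop_left]

/-- The automorphism that permutes the subtrees below the root by an element of `H`. -/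
def rooted (σ : H) : W H :=
  ⟨{ toFun := fun v => match v with | [] => [] | i :: v => (σ : Equiv.Perm (Fin d)) i :: v
     invFun := fun v => match v with
      | [] => []
      | i :: v => (σ : Equiv.Perm (Fin d)).symm i :: v
     left_inv := fun v => by cases v <;> simp
     right_inv := fun v => by cases v <;> simp }, by
    refine ⟨⟨fun v => ?_, fun v w => ?_⟩, fun v => ?_⟩
    · cases v <;> simp
    · cases v <;> cases w <;> simp [List.cons_prefix_cons]
    · cases v with
      | nil => exact ⟨σ, σ.2, fun i => rfl⟩
      | cons j v => exact ⟨1, one_mem _, fun i => rfl⟩⟩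

theorem rooted_smul_cons (σ : H) (i : Fin d) (v : Vertex d) :
    rooted σ • (i :: v) = (σ : Equiv.Perm (Fin d)) i :: v := rfl

end Construction

/-! ### Continuity and measurability -/

section Topology

theorem continuous_iff {X : Type*} [TopologicalSpace X] {f : X → W H} :
    Continuous f ↔ ∀ x, ∀ v : Vertex d, ∀ᶠ y in 𝓝 x, f y • v = f x • v := by
  simp only [continuous_iff_continuousAt, ContinuousAt, tendsto_iff]

theorem continuous_β (v : Vertex d) : Continuous fun g : W H => β g v := by
  refine continuous_iff.2 fun g w => ?_
  filter_upwards [eventually_smul_eq g (v ++ w)] with x hx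
  change (x • (v ++ w)).drop v.length = (g • (v ++ w)).drop v.length
  rw [hx]

theorem continuous_levelIns (n : ℕ) : Continuous (levelIns n : (Vertex d → W H) → W H) := by
  refine continuous_iff.2 fun c v => ?_
  filter_upwards [(continuous_apply (v.take n)).continuousAt.eventually
    (eventually_smul_eq (c (v.take n)) (v.drop n))] with c' hc
  rw [levelIns_smul, levelIns_smul, hc]

instance : SecondCountableTopology (W H) := by
  let _ : TopologicalSpace (Vertex d) := ⊥
  have : DiscreteTopology (Vertex d) := ⟨rfl⟩
  have h : IsInducing (fun (x : W H) (v : Vertex d) => x • v) := ⟨rfl⟩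
  exact h.secondCountableTopology

theorem isOpen_setOf_smul_eq (v w : Vertex d) : IsOpen {g : W H | g • v = w} := by
  rw [isOpen_iff_mem_nhds]
  rintro g rfl
  exact eventually_smul_eq g v

theorem measurableSet_smul_eq (v w : Vertex d) : MeasurableSet {g : W H | g • v = w} :=
  (isOpen_setOf_smul_eq v w).measurableSet

theorem continuous_lift {ι : Type*} (g : FreeGroup ι) :
    Continuous fun a : ι → W H => FreeGroup.lift a g := by
  induction g using FreeGroup.induction_on with
  | C1 => simpa using continuous_const
  | of i => simpa using continuous_apply i
  | inv_of i _ =>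
    simp only [map_inv, FreeGroup.lift_apply_of]
    exact (continuous_apply i).inv
  | mul x y hx hy =>
    simp only [map_mul]
    exact hx.mul hy

end Topology

/-! ### Invariance of the Haar measure -/

section Haar

/-- Right translates and the inverse of the Haar measure are left-invariant probability measures, so
uniqueness makes it bi-invariant and inversion-invariant. -/
theorem eq_haar (μ : Measure (W H)) [IsProbabilityMeasure μ] [μ.IsMulLeftInvariant] :
    μ = haar H := by
  have h1 : (haar H).IsHaarMeasure := inferInstanceAs (Measure.haarMeasure ⊤).IsHaarMeasure
  have h := Measure.isMulInvariant_eq_smul_of_compactSpace μ (haar H)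
  have h2 := congrArg (fun ν => ν Set.univ) h
  simp only [measure_univ, Measure.smul_apply, ENNReal.smul_def, smul_eq_mul, mul_one] at h2
  rw [h]
  ext s _
  simp [ENNReal.smul_def, ← h2]

instance : (haar H).IsHaarMeasure := inferInstanceAs (Measure.haarMeasure ⊤).IsHaarMeasure

instance : (haar H).IsMulRightInvariant where
  map_mul_right_eq_self g := by
    have : IsProbabilityMeasure (Measure.map (· * g) (haar H)) :=
      Measure.isProbabilityMeasure_map (measurable_mul_const g).aemeasurable
    exact eq_haar _

instance : (haar H).IsInvInvariant where
  inv_eq_self := by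
    have : IsProbabilityMeasure (haar H).inv :=
      Measure.isProbabilityMeasure_map measurable_inv.aemeasurable
    exact eq_haar _

instance (k : ℕ) : IsProbabilityMeasure (homMeasure H k) :=
  inferInstanceAs (IsProbabilityMeasure (Measure.pi _))

instance (k : ℕ) : (homMeasure H k).IsMulRightInvariant :=
  inferInstanceAs (Measure.IsMulRightInvariant (Measure.pi _))

theorem measurePreserving_mul_zpow_mul {k : ℕ} (A B : Fin k → W H) (ε : Fin k → Bool) :
    MeasurePreserving (fun (c : Fin k → W H) i => A i * (if ε i then c i else (c i)⁻¹) * B i)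
      (homMeasure H k) (homMeasure H k) := by
  refine measurePreserving_pi (fun _ => haar H) (fun _ => haar H)
    (f := fun i c => A i * (if ε i then c else c⁻¹) * B i) fun i => ?_
  have h1 : MeasurePreserving (fun c : W H => if ε i then c else c⁻¹) (haar H) (haar H) := by
    cases ε i
    · simpa using Measure.measurePreserving_inv (haar H)
    · exact MeasurePreserving.id (haar H)
  exact (measurePreserving_mul_right _ (B i)).comp
    ((measurePreserving_mul_left _ (A i)).comp h1)

end Haar

end IteratedWreath

namespace IteratedWreath

open Filter Topology
open FreeGroup hiding map map_mul map_one map_inv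

variable {d : ℕ} {H : Subgroup (Equiv.Perm (Fin d))}

/-! ### Data determined by the action on one level -/

section LevelAction

/-- The action of the generators on the level `n`. -/
def levelAction (n : ℕ) {ι : Type*} (a : ι → W H) (i : ι) (v : {v : Vertex d // v.length = n}) :
    {v : Vertex d // v.length = n} :=
  ⟨a i • (v : Vertex d), by rw [length_smul, v.2]⟩

instance (n : ℕ) : Finite {v : Vertex d // v.length = n} :=
  (List.finite_length_eq (Fin d) n).to_subtype

variable {ι : Type*} {n : ℕ} {a a' : ι → W H}

theorem levelAction_eq_iff :
    levelAction n a = levelAction n a' ↔ ∀ i, ∀ v : Vertex d, v.length = n → a i • v = a' i • v := by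
  constructor
  · intro h i v hv
    exact congrArg Subtype.val (congrFun (congrFun h i) ⟨v, hv⟩)
  · intro h
    funext i v
    exact Subtype.ext (h i v v.2)

theorem levelAction_eq_of_le {k : ℕ} (hk : k ≤ n) (h : levelAction n a = levelAction n a') :
    levelAction k a = levelAction k a' := by
  rw [levelAction_eq_iff] at h ⊢
  intro i v hv
  rcases v with _ | ⟨j, v⟩
  · rw [smul_nil, smul_nil]
  · set u := j :: v
    have h1 := h i (u ++ List.replicate (n - k) j) (by simp; omega)
    have h2 := congrArg (List.take k) h1
    rwa [take_smul, take_smul, ← hv, List.take_left] at h2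

theorem lift_smul_eq (h : levelAction n a = levelAction n a') (g : FreeGroup ι) {v : Vertex d}
    (hv : v.length = n) : FreeGroup.lift a g • v = FreeGroup.lift a' g • v := by
  rw [levelAction_eq_iff] at h
  induction g using FreeGroup.induction_on generalizing v with
  | C1 => simp
  | of i => simpa using h i v hv
  | inv_of i _ =>
    simp only [map_inv, FreeGroup.lift_apply_of]
    rw [inv_smul_eq_iff, h i _ (by rw [length_smul, hv]), smul_inv_smul]
  | mul x y hx hy =>
    rw [map_mul, map_mul, mul_smul, mul_smul, hy hv, hx (by rw [length_smul, hv])]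

theorem edges_lift_eq (h : levelAction n a = levelAction n a') {v : Vertex d}
    (hv : v.length = n) (w : List (ι × Bool)) :
    edges (FreeGroup.lift a) v w = edges (FreeGroup.lift a') v w := by
  induction w with
  | nil => rfl
  | cons l w ih => rw [edges_cons, edges_cons, ih, lift_smul_eq h _ hv, lift_smul_eq h _ hv]

theorem traversesOnce_lift_iff (h : levelAction n a = levelAction n a') {v : Vertex d}
    (hv : v.length = n) {w : List (ι × Bool)} {e : ι × Vertex d} :
    TraversesOnce (FreeGroup.lift a) v w e ↔ TraversesOnce (FreeGroup.lift a') v w e := by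
  simp only [TraversesOnce, stepEdge]
  refine exists_congr fun P => exists_congr fun l => exists_congr fun Q => ?_
  rw [lift_smul_eq h _ hv, lift_smul_eq h _ hv, edges_lift_eq h hv,
    edges_lift_eq h (by rw [length_smul, hv])]

theorem havePrivateEdges_lift_iff (h : levelAction n a = levelAction n a') {v : Vertex d}
    (hv : v.length = n) {κ : Type*} {α : κ → FreeGroup ι} :
    HavePrivateEdges (FreeGroup.lift a) v α ↔ HavePrivateEdges (FreeGroup.lift a') v α := by
  simp only [HavePrivateEdges, traversesOnce_lift_iff h hv, edges_lift_eq h hv]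

theorem mem_levelOrbits_map_iff (h : levelAction n a = levelAction n a')
    (Δ : Subgroup (FreeGroup ι)) (Z : Set (Vertex d)) :
    Z ∈ levelOrbits (Δ.map (FreeGroup.lift a)) n ↔
      Z ∈ levelOrbits (Δ.map (FreeGroup.lift a')) n := by
  have key : ∀ u : Vertex d, u.length = n → MulAction.orbit (Δ.map (FreeGroup.lift a)) u =
      MulAction.orbit (Δ.map (FreeGroup.lift a')) u := by
    intro u hu
    ext z
    constructor
    · rintro ⟨⟨_, x, hx, rfl⟩, rfl⟩
      exact ⟨⟨_, x, hx, rfl⟩, (lift_smul_eq h x hu).symm⟩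
    · rintro ⟨⟨_, x, hx, rfl⟩, rfl⟩
      exact ⟨⟨_, x, hx, rfl⟩, lift_smul_eq h x hu⟩
  refine exists_congr fun u => and_congr_right fun hu => ?_
  rw [key u hu]

end LevelAction

/-! ### Resampling the sections below a level -/

section Twist

variable {ι : Type*}

theorem β_inv (g : W H) (v : Vertex d) : β g⁻¹ v = (β g (g⁻¹ • v))⁻¹ := by
  have h := β_mul g g⁻¹ v
  rw [mul_inv_cancel, β_one] at h
  exact eq_inv_of_mul_eq_one_right h.symm

/-- Change the generators below the vertices of the level `n`. -/
def twist (n : ℕ) (a : ι → W H) (c : ι × Vertex d → W H) (i : ι) : W H :=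
  a i * levelIns n fun u => c (i, u)

variable {n : ℕ} {a : ι → W H}

theorem levelAction_twist (c : ι × Vertex d → W H) :
    levelAction n (twist n a c) = levelAction n a := by
  rw [levelAction_eq_iff]
  intro i v hv
  rw [twist, mul_smul, levelIns_smul_of_length _ hv.le]

theorem β_twist (c : ι × Vertex d → W H) (i : ι) {v : Vertex d} (hv : v.length = n) :
    β (twist n a c i) v = β (a i) v * c (i, v) := by
  rw [twist, β_mul, levelIns_smul_of_length _ hv.le, β_levelIns _ hv]

/-- The twist inserts `c (i, u)` at the source of the edge `(i, u)`: a positive letter picks it up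
on the right, an inverse letter picks up its inverse on the left. -/
theorem β_lift_twist_letter (c : ι × Vertex d → W H) (l : ι × Bool) (w : List (ι × Bool))
    {v : Vertex d} (hv : v.length = n) :
    β (FreeGroup.lift (twist n a c) (mk [l])) (FreeGroup.lift a (mk w) • v) =
      if l.2 then β (FreeGroup.lift a (mk [l])) (FreeGroup.lift a (mk w) • v) *
        c (stepEdge (FreeGroup.lift a) v l w)
      else (c (stepEdge (FreeGroup.lift a) v l w))⁻¹ *
        β (FreeGroup.lift a (mk [l])) (FreeGroup.lift a (mk w) • v) := by
  obtain ⟨i, b⟩ := l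
  have hu : (FreeGroup.lift a (mk w) • v).length = n := by rw [length_smul, hv]
  cases b
  · have h1 (b : ι → W H) : FreeGroup.lift b (mk [(i, false)]) = (b i)⁻¹ := by simp
    have h2 : (twist n a c i)⁻¹ • FreeGroup.lift a (mk w) • v =
        (a i)⁻¹ • FreeGroup.lift a (mk w) • v := by
      have := lift_smul_eq (levelAction_twist (a := a) c) (mk [(i, false)]) hu
      rwa [h1, h1] at this
    simp only [stepEdge, Bool.false_eq_true, if_false]
    rw [mk_cons_eq (i, false) w, map_mul, mul_smul, h1, h1, β_inv, β_inv, h2,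
      β_twist c i (by rw [length_smul, hu]), mul_inv_rev]
  · have h1 (b : ι → W H) : FreeGroup.lift b (mk [(i, true)]) = b i := by simp
    simp only [stepEdge, if_true]
    rw [h1, h1, β_twist c i hu]

theorem β_lift_twist_cons (c : ι × Vertex d → W H) (w x : List (ι × Bool))
    {v : Vertex d} (hv : v.length = n) :
    β (FreeGroup.lift (twist n a c) (mk (w ++ x))) v =
      β (FreeGroup.lift (twist n a c) (mk w)) (FreeGroup.lift a (mk x) • v) *
        β (FreeGroup.lift (twist n a c) (mk x)) v := by
  rw [← mul_mk, map_mul, β_mul, lift_smul_eq (levelAction_twist c) _ hv]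

theorem β_lift_twist_of_forall (c : ι × Vertex d → W H) {w : List (ι × Bool)} {v : Vertex d}
    (hv : v.length = n) (hc : ∀ e ∈ edges (FreeGroup.lift a) v w, c e = 1) :
    β (FreeGroup.lift (twist n a c) (mk w)) v = β (FreeGroup.lift a (mk w)) v := by
  induction w with
  | nil => rw [← one_eq_mk, map_one, map_one]
  | cons l w ih =>
    rw [← List.singleton_append, β_lift_twist_cons c _ _ hv, β_lift_twist_letter c l w hv,
      hc (stepEdge (FreeGroup.lift a) v l w) (by rw [edges_cons]; exact List.mem_cons_self),
      ih fun e he => hc e (by rw [edges_cons]; exact List.mem_cons_of_mem _ he),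
      ← mul_mk, map_mul, β_mul]
    simp

/-- The section of a word is the product of the sections along its path, and only the single step
over `e` sees `c e`. It matters that `A`, `B` and `ε` do not depend on `c`. -/
theorem exists_β_lift_twist_eq {w : List (ι × Bool)} {e : ι × Vertex d} {v : Vertex d}
    (hv : v.length = n) (he : TraversesOnce (FreeGroup.lift a) v w e) :
    ∃ (A B : W H) (ε : Bool), ∀ c : ι × Vertex d → W H,
      (∀ e' ∈ edges (FreeGroup.lift a) v w, e' ≠ e → c e' = 1) →
        β (FreeGroup.lift (twist n a c) (mk w)) v = A * (if ε then c e else (c e)⁻¹) * B := by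
  obtain ⟨P, l, Q, rfl, rfl, hP, hQ⟩ := he
  set e := stepEdge (FreeGroup.lift a) v l Q
  set u := FreeGroup.lift a (mk Q) • v
  set AP := β (FreeGroup.lift a (mk P)) (FreeGroup.lift a (mk (l :: Q)) • v)
  set BQ := β (FreeGroup.lift a (mk Q)) v
  set X := β (FreeGroup.lift a (mk [l])) u
  refine ⟨if l.2 then AP * X else AP, if l.2 then BQ else X * BQ, l.2, fun c hc => ?_⟩
  rw [edges_append, edges_cons] at hc
  have h1 : β (FreeGroup.lift (twist n a c) (mk P)) (FreeGroup.lift a (mk (l :: Q)) • v) = AP :=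
    β_lift_twist_of_forall c (by rw [length_smul, hv]) fun e' he' =>
      hc e' (List.mem_append_left _ he') fun h => hP (h ▸ he')
  have h2 : β (FreeGroup.lift (twist n a c) (mk Q)) v = BQ :=
    β_lift_twist_of_forall c hv fun e' he' =>
      hc e' (List.mem_append_right _ (List.mem_cons_of_mem _ he')) fun h => hQ (h ▸ he')
  rw [β_lift_twist_cons c _ _ hv, h1, ← List.singleton_append, β_lift_twist_cons c _ _ hv,
    β_lift_twist_letter c l Q hv, h2]
  cases l.2 <;> simp [mul_assoc, e, X, u]

end Twist

/-! ### Independence of sections with private edges -/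

section Law

variable {m n K : ℕ}

theorem measurableSet_levelAction_preimage
    (S : Set (Fin m → {v : Vertex d // v.length = n} → {v : Vertex d // v.length = n})) :
    MeasurableSet {a : Fin m → W H | levelAction n a ∈ S} := by
  have hS : S.Countable := Set.to_countable S
  have h1 : {a : Fin m → W H | levelAction n a ∈ S} = ⋃ σ ∈ S, {a | levelAction n a = σ} := by
    ext a; simp
  rw [h1]
  refine MeasurableSet.biUnion hS fun σ _ => ?_
  have h2 : {a : Fin m → W H | levelAction n a = σ} =
      ⋂ i, ⋂ v : {v : Vertex d // v.length = n}, {a | a i • (v : Vertex d) = σ i v} := by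
    ext a
    simp only [Set.mem_ofPred_eq, Set.mem_iInter, funext_iff, Subtype.ext_iff]
    rfl
  rw [h2]
  exact MeasurableSet.iInter fun i => MeasurableSet.iInter fun v =>
    (measurable_pi_apply i : Measurable fun a : Fin m → W H => a i)
      (measurableSet_smul_eq (v : Vertex d) (σ i v : Vertex d))

theorem measurable_β_lift (v : Vertex d) (α : Fin K → FreeGroup (Fin m)) :
    Measurable fun (a : Fin m → W H) k => β (FreeGroup.lift a (α k)) v :=
  (continuous_pi fun k => (continuous_β v).comp (continuous_lift (α k))).measurable

/-- Given the action on the level `n`, the local actions at `v` of elements with private edges are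
independent and Haar distributed. -/
theorem measure_levelAction_inter_preimage {a₀ : Fin m → W H} {v : Vertex d} (hv : v.length = n)
    {α : Fin K → FreeGroup (Fin m)} (hα : HavePrivateEdges (FreeGroup.lift a₀) v α)
    {B : Set (Fin K → W H)} (hB : MeasurableSet B) :
    homMeasure H m {a | levelAction n a = levelAction n a₀ ∧
      (fun k => β (FreeGroup.lift a (α k)) v) ∈ B} =
    homMeasure H m {a | levelAction n a = levelAction n a₀} * homMeasure H K B := by
  obtain ⟨w, e, hw, he, he'⟩ := hα
  have hinj : Function.Injective e := by
    intro k k' hk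
    by_contra hne
    exact he' k k' (Ne.symm hne) (hk ▸ (he k').mem)
  set Φ : (Fin m → W H) → Fin K → W H := fun a k => β (FreeGroup.lift a (α k)) v with hΦ
  -- Multiplying by `t γ` on the right twists by `γ k` at the private edge `e k` and by `1` at all
  -- other edges.
  let t (γ : Fin K → W H) (i : Fin m) : W H :=
    levelIns n fun u => Function.extend e γ 1 (i, u)
  have htw (γ : Fin K → W H) (a : Fin m → W H) : a * t γ = twist n a (Function.extend e γ 1) := rfl
  have htcont : Continuous t := by
    refine continuous_pi fun i => (continuous_levelIns n).comp (continuous_pi fun u => ?_)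
    by_cases h : ∃ k, e k = (i, u)
    · obtain ⟨k, hk⟩ := h
      simp only [← hk, hinj.extend_apply]
      exact continuous_apply k
    · simp only [Function.extend_apply' _ _ _ h]
      exact continuous_const
  set C : Set (Fin m → W H) := {a | levelAction n a = levelAction n a₀} with hC
  have hCm : MeasurableSet C := measurableSet_levelAction_preimage {levelAction n a₀}
  have hΦm : Measurable Φ := measurable_β_lift v α
  have hCt (γ : Fin K → W H) (a : Fin m → W H) : a * t γ ∈ C ↔ a ∈ C := by
    rw [htw, hC, Set.mem_ofPred_eq, levelAction_twist, Set.mem_ofPred_eq]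
  -- The measure of `S` is computed twice. For fixed `γ`, right invariance removes `t γ`. For fixed
  -- `a ∈ C`, each coordinate of `Φ (a * t γ)` is a two-sided translate of `γ k` or its inverse, so
  -- the vector has the law of `γ`.
  let S : Set ((Fin K → W H) × (Fin m → W H)) := {p | p.2 ∈ C ∧ Φ (p.2 * t p.1) ∈ B}
  have hS : MeasurableSet S := by
    refine (measurable_snd hCm).inter ?_
    exact (hΦm.comp (measurable_snd.mul (htcont.measurable.comp measurable_fst))) hB
  have h1 : ((homMeasure H K).prod (homMeasure H m)) S = homMeasure H m (C ∩ Φ ⁻¹' B) := by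
    rw [Measure.prod_apply hS]
    have h2 (γ : Fin K → W H) : homMeasure H m (Prod.mk γ ⁻¹' S) =
        homMeasure H m (C ∩ Φ ⁻¹' B) := by
      rw [← (measurePreserving_mul_right (homMeasure H m) (t γ)).measure_preimage
        (hCm.inter (hΦm hB)).nullMeasurableSet]
      congr 1
      ext a
      exact and_congr_left fun _ => (hCt γ a).symm
    simp [h2]
  have h3 : ((homMeasure H K).prod (homMeasure H m)) S =
      homMeasure H m C * homMeasure H K B := by
    rw [Measure.prod_apply_symm hS]
    have h4 (a : Fin m → W H) : homMeasure H K ((fun γ => (γ, a)) ⁻¹' S) =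
        C.indicator (fun _ => homMeasure H K B) a := by
      by_cases ha : a ∈ C
      · rw [Set.indicator_of_mem ha]
        have h5 (k : Fin K) : ∃ (A A' : W H) (ε : Bool), ∀ γ : Fin K → W H,
            Φ (a * t γ) k = A * (if ε then γ k else (γ k)⁻¹) * A' := by
          obtain ⟨A, A', ε, h⟩ := exists_β_lift_twist_eq hv
            ((traversesOnce_lift_iff (a := a) (a' := a₀) ha hv).2 (he k))
          refine ⟨A, A', ε, fun γ => ?_⟩
          rw [hΦ, htw, ← hinj.extend_apply γ 1 k]
          change β (FreeGroup.lift _ (α k)) v = _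
          rw [← hw k, h]
          intro e' hee' hne
          refine Function.extend_apply' _ _ _ ?_
          rintro ⟨k', rfl⟩
          rw [edges_lift_eq ha hv] at hee'
          exact he' k' k (fun h => hne (h ▸ rfl)) hee'
        choose A A' ε h5 using h5
        rw [← (measurePreserving_mul_zpow_mul A A' ε).measure_preimage hB.nullMeasurableSet]
        congr 1
        ext γ
        have h6 : Φ (a * t γ) = fun k => A k * (if ε k then γ k else (γ k)⁻¹) * A' k :=
          funext fun k => h5 k γ
        simp [S, ha, h6]
      · rw [Set.indicator_of_notMem ha]
        simp [S, ha]
    simp only [h4]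
    rw [lintegral_indicator_const hCm, mul_comm]
  rw [← h3, h1]
  rfl

theorem ae_of_havePrivateEdges {p : (Fin K → W H) → Prop} (hp : ∀ᵐ b ∂homMeasure H K, p b)
    (v : Vertex d) (α : Fin K → FreeGroup (Fin m)) :
    ∀ᵐ a ∂homMeasure H m, HavePrivateEdges (FreeGroup.lift a) v α →
      p fun k => β (FreeGroup.lift a (α k)) v := by
  have h : ∀ σ : Fin m → {u : Vertex d // u.length = v.length} →
      {u : Vertex d // u.length = v.length}, ∀ᵐ a ∂homMeasure H m, levelAction v.length a = σ →
        HavePrivateEdges (FreeGroup.lift a) v α → p fun k => β (FreeGroup.lift a (α k)) v := by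
    intro σ
    by_cases hσ : ∃ a₀ : Fin m → W H, levelAction v.length a₀ = σ ∧
        HavePrivateEdges (FreeGroup.lift a₀) v α
    · obtain ⟨a₀, rfl, hα⟩ := hσ
      -- The set where `p` fails need not be measurable, so it is replaced by a measurable null set
      -- containing it.
      have h1 := measure_levelAction_inter_preimage rfl hα
        (measurableSet_toMeasurable (homMeasure H K) {b | ¬ p b})
      rw [measure_toMeasurable, ae_iff.1 hp, mul_zero] at h1
      refine measure_mono_null ?_ h1
      intro a ha
      simp only [Set.mem_compl_iff, Set.mem_ofPred_eq, Classical.not_imp] at ha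
      exact ⟨ha.1, subset_toMeasurable _ _ ha.2.2⟩
    · push Not at hσ
      exact Eventually.of_forall fun a h1 h2 => absurd h2 (hσ a h1)
  filter_upwards [ae_all_iff.2 h] with a ha
  exact ha _ rfl

end Law

end IteratedWreath

namespace IteratedWreath

open Filter Topology
open scoped NNReal ENNReal
open FreeGroup hiding map map_mul map_one map_inv

variable {d : ℕ} {H : Subgroup (Equiv.Perm (Fin d))}

/-! ### Extinction of the fixed vertices of a random element -/

section Extinction

/-- The elements without fixed vertices on the level `n`. -/
def derangements (H : Subgroup (Equiv.Perm (Fin d))) (n : ℕ) : Set (W H) :=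
  {g | ∀ v : Vertex d, v.length = n → g • v ≠ v}

theorem measurableSet_derangements (n : ℕ) : MeasurableSet (derangements H n) := by
  have : derangements H n = ⋂ v : Vertex d, ⋂ _ : v.length = n, {g | g • v = v}ᶜ := by
    ext g; simp [derangements]
  rw [this]
  exact MeasurableSet.iInter fun v => MeasurableSet.iInter fun _ =>
    (measurableSet_smul_eq v v).compl

/-- The number of fixed vertices on the first level. -/
def fixCount (g : W H) : ℕ := (Finset.univ.filter fun i : Fin d => g • ([i] : Vertex d) = [i]).card

/-- The automorphism that acts as `c i` on the subtree below the vertex `i` of the first level. -/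
def firstLevelIns (c : Fin d → W H) : W H :=
  levelIns 1 fun u => match u with | [] => 1 | i :: _ => c i

theorem continuous_firstLevelIns : Continuous (firstLevelIns : (Fin d → W H) → W H) := by
  refine (continuous_levelIns 1).comp (continuous_pi fun u => ?_)
  cases u with
  | nil => exact continuous_const
  | cons i _ => exact continuous_apply i

theorem mul_firstLevelIns_mem_derangements (g : W H) (c : Fin d → W H) (n : ℕ) :
    g * firstLevelIns c ∈ derangements H (n + 1) ↔
      ∀ i, g • ([i] : Vertex d) = [i] → β g [i] * c i ∈ derangements H n := by
  have key (i : Fin d) (w : Vertex d) : (g * firstLevelIns c) • (i :: w : Vertex d) =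
        g • ([i] : Vertex d) ++ (β g [i] * c i) • w := by
    rw [mul_smul, firstLevelIns, levelIns_smul, mul_smul, ← smul_append_eq]
    rfl
  constructor
  · intro h i hi w hw hfix
    refine h (i :: w) (by simp [hw]) ?_
    rw [key, hi, hfix]
    rfl
  · intro h v hv hfix
    obtain ⟨i, w, rfl⟩ := List.exists_cons_of_length_eq_add_one hv
    rw [key] at hfix
    have h1 := List.append_inj (s₂ := [i]) (t₂ := w) hfix (by rw [length_smul])
    exact h i h1.1 w (by simpa using hv) h1.2

/-- The recursion of a branching process. Right multiplication by a random `firstLevelIns c`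
preserves the Haar measure and makes the sections at the fixed vertices of the first level
independent and Haar distributed; each of them must be a derangement of level `n`. -/
theorem haar_derangements_succ (n : ℕ) :
    haar H (derangements H (n + 1)) = ∫⁻ g, haar H (derangements H n) ^ fixCount g ∂haar H := by
  have hmeas : Measurable fun p : (Fin d → W H) × W H => p.2 * firstLevelIns p.1 :=
    measurable_snd.mul (continuous_firstLevelIns.measurable.comp measurable_fst)
  set S := (fun p : (Fin d → W H) × W H => p.2 * firstLevelIns p.1) ⁻¹' derangements H (n + 1)
    with hSdef
  have hS : MeasurableSet S := hmeas (measurableSet_derangements (n + 1))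
  have h1 : ((homMeasure H d).prod (haar H)) S = haar H (derangements H (n + 1)) := by
    rw [Measure.prod_apply hS]
    have h2 (c : Fin d → W H) : haar H (Prod.mk c ⁻¹' S) = haar H (derangements H (n + 1)) := by
      have h : Prod.mk c ⁻¹' S = (fun g => g * firstLevelIns c) ⁻¹' derangements H (n + 1) := by
        rw [hSdef]
        rfl
      rw [h, measure_preimage_mul_right]
    simp only [h2, lintegral_const, measure_univ, mul_one]
  rw [← h1, Measure.prod_apply_symm hS]
  refine lintegral_congr fun g => ?_
  have h3 : (fun c => (c, g)) ⁻¹' S = Set.univ.pi fun i =>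
      if g • ([i] : Vertex d) = [i] then (fun x => β g [i] * x) ⁻¹' derangements H n
      else Set.univ := by
    ext c
    refine (mul_firstLevelIns_mem_derangements g c n).trans ?_
    simp only [Set.mem_pi, Set.mem_univ, true_implies]
    refine forall_congr' fun i => ?_
    split_ifs with hi <;> simp [hi]
  rw [h3, homMeasure, Measure.pi_pi]
  have h4 (i : Fin d) : haar H (if g • ([i] : Vertex d) = [i] then
      (fun x => β g [i] * x) ⁻¹' derangements H n else Set.univ) =
      if g • ([i] : Vertex d) = [i] then haar H (derangements H n) else 1 := by
    split_ifs
    · exact measure_preimage_mul _ _ _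
    · exact measure_univ
  simp only [h4]
  rw [Finset.prod_ite, Finset.prod_const, Finset.prod_const_one, mul_one]
  rfl

/-- By transitivity each vertex of the first level is fixed with probability `1 / d`, so the
branching process is critical. -/
theorem lintegral_fixCount (hH : MulAction.IsPretransitive H (Fin d)) (hd : d ≠ 0) :
    ∫⁻ g : W H, (fixCount g : ℝ≥0∞) ∂haar H = 1 := by
  have h1 (g : W H) : (fixCount g : ℝ≥0∞) =
      ∑ i, {g : W H | g • ([i] : Vertex d) = [i]}.indicator (fun _ => (1 : ℝ≥0∞)) g := by
    rw [fixCount, Finset.card_filter, Nat.cast_sum]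
    refine Finset.sum_congr rfl fun i _ => ?_
    simp [Set.indicator_apply]
  simp only [h1]
  rw [lintegral_finsetSum _ fun i _ =>
    measurable_const.indicator (measurableSet_smul_eq _ _)]
  have h2 (i : Fin d) : ∫⁻ g : W H, {g : W H | g • ([i] : Vertex d) = [i]}.indicator
      (fun _ => (1 : ℝ≥0∞)) g ∂haar H = (d : ℝ≥0∞)⁻¹ := by
    rw [lintegral_indicator_const (measurableSet_smul_eq _ _), one_mul]
    have h3 (j : Fin d) : haar H {g : W H | g • ([i] : Vertex d) = [j]} =
        haar H {g : W H | g • ([i] : Vertex d) = [i]} := by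
      obtain ⟨σ, hσ⟩ := MulAction.exists_smul_eq H i j
      rw [← measure_preimage_mul (haar H) (rooted σ)]
      congr 1
      ext g
      change (rooted σ * g) • ([i] : Vertex d) = [j] ↔ g • ([i] : Vertex d) = [i]
      have : rooted σ • ([i] : Vertex d) = [j] := by
        rw [rooted_smul_cons, ← hσ]; rfl
      rw [mul_smul, ← this]
      exact ⟨fun h => smul_left_cancel _ h, fun h => by rw [h]⟩
    have h4 : haar H (⋃ j, {g : W H | g • ([i] : Vertex d) = [j]}) =
        ∑ j, haar H {g : W H | g • ([i] : Vertex d) = [j]} := by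
      rw [measure_iUnion ?_ fun j => measurableSet_smul_eq _ _, tsum_fintype]
      intro j k hjk
      refine Set.disjoint_left.2 fun g hj hk => hjk ?_
      have : ([j] : Vertex d) = [k] := (show g • ([i] : Vertex d) = [j] from hj).symm.trans hk
      simpa using this
    have h5 : (⋃ j, {g : W H | g • ([i] : Vertex d) = [j]}) = Set.univ := by
      refine Set.eq_univ_of_forall fun g => Set.mem_iUnion.2 ?_
      obtain ⟨j, hj⟩ := List.length_eq_one_iff.1 (length_smul g ([i] : Vertex d))
      exact ⟨j, hj⟩
    rw [h5, measure_univ] at h4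
    simp only [h3, Finset.sum_const, Finset.card_univ, Fintype.card_fin, nsmul_eq_mul] at h4
    exact ENNReal.eq_inv_of_mul_eq_one_left (by rw [mul_comm]; exact h4.symm)
  simp only [h2, Finset.sum_const, Finset.card_univ, Fintype.card_fin, nsmul_eq_mul]
  exact ENNReal.mul_inv_cancel (by exact_mod_cast hd) (ENNReal.natCast_ne_top d)

/-- Bernoulli's inequality for `(1 - y) ^ k` with a second-order gain when `k ≥ 2`; this gain drives
the extinction. -/
theorem one_add_le_pow_add {x y : ℝ≥0} (hxy : x + y = 1) (k : ℕ) :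
    1 + (if 2 ≤ k then y ^ 2 else 0) ≤ x ^ k + k * y := by
  have hx : (x : ℝ) = 1 - y := by
    have := congrArg NNReal.toReal hxy
    push_cast at this
    linarith
  have hx0 : (0 : ℝ) ≤ 1 - y := hx ▸ x.2
  have hy0 : (0 : ℝ) ≤ y := y.2
  rw [← NNReal.coe_le_coe]
  rcases lt_or_ge k 2 with hk | hk
  · interval_cases k <;> simp [hx]
  · rw [if_pos hk]
    push_cast
    rw [hx]
    induction k, hk using Nat.le_induction with
    | base => apply le_of_eq; push_cast; ring
    | succ k hk ih =>
      have h1 := mul_le_mul_of_nonneg_right ih hx0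
      have hk' : (y : ℝ) ≤ k := by
        have : (2 : ℝ) ≤ k := by exact_mod_cast hk
        linarith
      have h2 := mul_le_mul_of_nonneg_right hk' (mul_nonneg hy0 hy0)
      rw [pow_succ (1 - (y : ℝ)) k]
      push_cast
      linarith

/-- The extinction of a critical branching process. -/
theorem tendsto_zero_of_le_sub_sq {r : ℕ → ℝ} {ρ : ℝ} (hρ : 0 < ρ) (h0 : ∀ n, 0 ≤ r n)
    (h : ∀ n, r (n + 1) ≤ r n - ρ * r n ^ 2) : Tendsto r atTop (𝓝 0) := by
  have hanti : Antitone r := antitone_nat_of_succ_le fun n => by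
    have := mul_nonneg hρ.le (sq_nonneg (r n)); linarith [h n]
  have hbdd : BddBelow (Set.range r) := ⟨0, by rintro _ ⟨n, rfl⟩; exact h0 n⟩
  have hlim := tendsto_atTop_ciInf hanti hbdd
  set L := ⨅ n, r n
  have h1 : L ≤ L - ρ * L ^ 2 :=
    le_of_tendsto_of_tendsto' (hlim.comp (tendsto_add_atTop_nat 1))
      (hlim.sub ((hlim.pow 2).const_mul ρ)) h
  have h2 : L ^ 2 ≤ 0 := by
    by_contra! h3
    have := mul_pos hρ h3
    linarith
  have h3 : L = 0 := by
    have := le_antisymm h2 (sq_nonneg L)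
    exact pow_eq_zero_iff two_ne_zero |>.1 this
  rwa [h3] at hlim

/-- A Haar-random element fixes no vertex of some level. -/
theorem ae_exists_mem_derangements (hH : MulAction.IsPretransitive H (Fin d)) (hd : 2 ≤ d) :
    ∀ᵐ g ∂haar H, ∃ n, g ∈ derangements H n := by
  let S : Set (W H) := {g | ∀ i : Fin d, g • ([i] : Vertex d) = [i]}
  have hSo : IsOpen S := by
    have : S = ⋂ i : Fin d, {g | g • ([i] : Vertex d) = [i]} := by ext; simp [S]
    rw [this]
    exact isOpen_iInter_of_finite fun i => isOpen_setOf_smul_eq _ _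
  have hS0 : 0 < haar H S := hSo.measure_pos _ ⟨1, fun i => one_smul _ _⟩
  have hSfix : ∀ g ∈ S, 2 ≤ fixCount g := by
    intro g hg
    rw [fixCount, Finset.filter_true_of_mem fun i _ => hg i, Finset.card_univ, Fintype.card_fin]
    exact hd
  let q (n : ℕ) : ℝ≥0 := (haar H (derangements H n)).toNNReal
  have hq (n : ℕ) : (q n : ℝ≥0∞) = haar H (derangements H n) :=
    ENNReal.coe_toNNReal (measure_ne_top _ _)
  have hq1 (n : ℕ) : q n ≤ 1 := by
    rw [← ENNReal.coe_le_coe, hq]; exact prob_le_one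
  set ρ : ℝ≥0 := (haar H S).toNNReal with hρ
  have hρe : (ρ : ℝ≥0∞) = haar H S := ENNReal.coe_toNNReal (measure_ne_top _ _)
  have hρ0 : 0 < ρ := by
    rw [← ENNReal.coe_pos, hρe]; exact hS0
  -- Integrate `one_add_le_pow_add` over the number of fixed vertices, which has mean `1` and is at
  -- least `2` on `S`. The survival probability `r = 1 - q` then drops by at least `ρ * r²` at each
  -- step.
  have hstep (n : ℕ) : 1 + (1 - q n) ^ 2 * ρ ≤ q (n + 1) + (1 - q n) := by
    set y := 1 - q n
    have hxy : q n + y = 1 := add_tsub_cancel_of_le (hq1 n)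
    have h1 : ∫⁻ g : W H, (1 + S.indicator (fun _ => (y : ℝ≥0∞) ^ 2) g) ∂haar H ≤
        ∫⁻ g : W H, ((q n : ℝ≥0∞) ^ fixCount g + y * fixCount g) ∂haar H := by
      refine lintegral_mono fun g => ?_
      have h2 := one_add_le_pow_add hxy (fixCount g)
      rw [← ENNReal.coe_le_coe] at h2
      refine le_trans ?_ (h2.trans_eq ?_)
      · by_cases hg : g ∈ S
        · rw [Set.indicator_of_mem hg, if_pos (hSfix g hg)]; push_cast; rfl
        · rw [Set.indicator_of_notMem hg]
          push_cast
          gcongr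
          exact zero_le
      · push_cast; ring
    have hfm : Measurable fun g : W H => (fixCount g : ℝ≥0∞) := by
      have h1 (g : W H) : (fixCount g : ℝ≥0∞) =
          ∑ i, {g : W H | g • ([i] : Vertex d) = [i]}.indicator (fun _ => (1 : ℝ≥0∞)) g := by
        rw [fixCount, Finset.card_filter, Nat.cast_sum]
        refine Finset.sum_congr rfl fun i _ => ?_
        simp [Set.indicator_apply]
      simp only [h1]
      exact Finset.measurable_fun_sum _ fun i _ =>
        measurable_const.indicator (measurableSet_smul_eq _ _)
    rw [lintegral_add_left measurable_const, lintegral_indicator_const hSo.measurableSet,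
      lintegral_const, measure_univ, mul_one, lintegral_add_right _ (hfm.const_mul _),
      lintegral_const_mul _ hfm, lintegral_fixCount hH (by omega), mul_one, hq,
      ← haar_derangements_succ, ← hq, ← hρe] at h1
    exact_mod_cast h1
  have hlim := tendsto_zero_of_le_sub_sq (r := fun n => 1 - (q n : ℝ)) (ρ := ρ)
    (by exact_mod_cast hρ0) (fun n => sub_nonneg.2 (by exact_mod_cast hq1 n)) (fun n => by
      have := hstep n
      rw [← NNReal.coe_le_coe] at this
      push_cast [NNReal.coe_sub (hq1 n)] at this
      linarith)
  rw [ae_iff]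
  by_contra hne
  set F : Set (W H) := {g | ¬ ∃ n, g ∈ derangements H n} with hF
  have hF0 : 0 < (haar H).real F := by
    rw [Measure.real]
    exact ENNReal.toReal_pos hne (measure_ne_top _ _)
  obtain ⟨n, hn⟩ := (hlim.eventually (gt_mem_nhds hF0)).exists
  have h1 : (haar H).real F ≤ (haar H).real (derangements H n)ᶜ :=
    measureReal_mono fun g hg hgn => hg ⟨n, hgn⟩
  rw [probReal_compl_eq_one_sub (measurableSet_derangements n)] at h1
  have h2 : (haar H).real (derangements H n) = q n := rfl
  rw [h2] at h1
  linarith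

end Extinction

/-! ### Absence of short loops on deep levels -/

section Freeness

theorem exists_append_of_le_length {k : ℕ} {v : Vertex d} (h : k ≤ v.length) :
    ∃ u x, v = u ++ x ∧ u.length = k :=
  ⟨v.take k, v.drop k, (List.take_append_drop _ _).symm, List.length_take_of_le h⟩

theorem derangements_mono {k n : ℕ} (h : k ≤ n) : derangements H k ⊆ derangements H n := by
  intro g hg v hv hfix
  refine hg (v.take k) (List.length_take_of_le (by omega)) ?_
  rw [← take_smul, hfix]

/-- Almost surely every nontrivial element fixes no vertex of some level. -/
theorem ae_forall_exists_derangement (hH : MulAction.IsPretransitive H (Fin d)) (hd : 2 ≤ d)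
    (m : ℕ) : ∀ᵐ a ∂homMeasure H m, ∀ w : List (Fin m × Bool), IsReduced w → w ≠ [] →
      ∃ n, FreeGroup.lift a (mk w) ∈ derangements H n := by
  have hmain : ∀ N : ℕ, ∀ᵐ a ∂homMeasure H m, ∀ w : List (Fin m × Bool), IsReduced w → w ≠ [] →
      w.length ≤ N → ∃ n, FreeGroup.lift a (mk w) ∈ derangements H n := by
    intro N
    induction N with
    | zero =>
      refine Eventually.of_forall fun a w _ hw0 hw => absurd ?_ hw0
      exact List.eq_nil_of_length_eq_zero (by omega)
    | succ N ih =>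
      have hext : ∀ (v : Vertex d) (w : List (Fin m × Bool)), ∀ᵐ a ∂homMeasure H m,
          HavePrivateEdges (FreeGroup.lift a) v (fun _ : Fin 1 => mk w) →
            ∃ n, β (FreeGroup.lift a (mk w)) v ∈ derangements H n := by
        intro v w
        have hp : ∀ᵐ b ∂homMeasure H 1, ∃ n, b 0 ∈ derangements H n :=
          (measurePreserving_eval (fun _ : Fin 1 => haar H) 0).quasiMeasurePreserving.ae
            (ae_exists_mem_derangements hH hd)
        exact ae_of_havePrivateEdges hp v fun _ => mk w
      filter_upwards [ih, ae_all_iff.2 fun v => ae_all_iff.2 (hext v)] with a ha hext w hw hw0 hwN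
      rcases Nat.lt_or_ge w.length (N + 1) with h | h
      · exact ha w hw hw0 (by omega)
      have hfin : {w : List (Fin m × Bool) | w.length ≤ N}.Finite := List.finite_length_le _ N
      have hn₀ : ∀ x : List (Fin m × Bool), ∃ n, IsReduced x → x ≠ [] → x.length ≤ N →
          FreeGroup.lift a (mk x) ∈ derangements H n := by
        intro x
        by_cases hx : IsReduced x ∧ x ≠ [] ∧ x.length ≤ N
        · obtain ⟨n, hn⟩ := ha x hx.1 hx.2.1 hx.2.2
          exact ⟨n, fun _ _ _ => hn⟩
        · exact ⟨0, fun h1 h2 h3 => absurd ⟨h1, h2, h3⟩ hx⟩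
      choose n₀ hn₀ using hn₀
      obtain ⟨n, hn⟩ := (hfin.image n₀).bddAbove
      -- On a level where no shorter nontrivial word has a fixed vertex, the path of `w` repeats no
      -- edge. The section of `w` at each vertex of this level is then covered by `hext`, hence
      -- deranges some level.
      have hfree : ∀ v : Vertex d, v.length = n → FreeUpTo (FreeGroup.lift a) N v := by
        intro v hv x hx hx0 hxN y
        refine derangements_mono (hn ⟨x, hxN, rfl⟩) (hn₀ x hx hx0 hxN) _ ?_
        rw [length_smul, hv]
      have hn₁ : ∀ v : Vertex d, ∃ k, v.length = n →
          β (FreeGroup.lift a (mk w)) v ∈ derangements H k := by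
        intro v
        by_cases hv : v.length = n
        · obtain ⟨k, hk⟩ := hext v w (by
            obtain ⟨l, w', rfl⟩ := List.exists_cons_of_ne_nil hw0
            refine ⟨fun _ => l :: w', fun _ => stepEdge (FreeGroup.lift a) v l w', fun _ => rfl,
              fun _ => ?_, fun i j hij => absurd (Subsingleton.elim j i) hij⟩
            exact TraversesOnce.of_nodup (P := []) ((hfree v hv).nodup_edges hw hwN))
          exact ⟨k, fun _ => hk⟩
        · exact ⟨0, fun h => absurd h hv⟩
      choose n₁ hn₁ using hn₁
      obtain ⟨k, hk⟩ := ((List.finite_length_eq (Fin d) n).image n₁).bddAbove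
      -- A fixed vertex of level `n + k` has a fixed prefix `u` on level `n`, and the section at `u`
      -- would fix a vertex of level `k`.
      refine ⟨n + k, fun v hv hfix => ?_⟩
      obtain ⟨u, x, rfl, hu⟩ := exists_append_of_le_length (v := v) (k := n) (by omega)
      rw [smul_append_eq] at hfix
      have h1 := List.append_inj hfix (length_smul _ _)
      refine derangements_mono (hk ⟨u, hu, rfl⟩) (hn₁ u hu) x ?_ h1.2
      rw [List.length_append] at hv
      omega
  filter_upwards [ae_all_iff.2 hmain] with a ha w hw hw0
  exact ha w.length w hw hw0 le_rfl

/-- Almost surely, for every `R`, the vertices of some level have no short loops around them. -/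
theorem ae_forall_exists_freeUpTo (hH : MulAction.IsPretransitive H (Fin d)) (hd : 2 ≤ d)
    (m : ℕ) : ∀ᵐ a ∂homMeasure H m, ∀ R : ℕ, ∃ n, ∀ v : Vertex d, v.length = n →
      FreeUpTo (FreeGroup.lift a) R v := by
  filter_upwards [ae_forall_exists_derangement hH hd m] with a ha R
  have hn₀ : ∀ x : List (Fin m × Bool), ∃ n, IsReduced x → x ≠ [] →
      FreeGroup.lift a (mk x) ∈ derangements H n := by
    intro x
    by_cases hx : IsReduced x ∧ x ≠ []
    · obtain ⟨n, hn⟩ := ha x hx.1 hx.2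
      exact ⟨n, fun _ _ => hn⟩
    · exact ⟨0, fun h1 h2 => absurd ⟨h1, h2⟩ hx⟩
  choose n₀ hn₀ using hn₀
  obtain ⟨n, hn⟩ := ((List.finite_length_le (Fin m × Bool) R).image n₀).bddAbove
  refine ⟨n, fun v hv x hx hx0 hxR y => ?_⟩
  refine derangements_mono (hn ⟨x, hxR, rfl⟩) (hn₀ x hx hx0) _ ?_
  rw [length_smul, hv]

end Freeness

end IteratedWreath

namespace IteratedWreath

open Filter Topology

variable {d : ℕ} {H : Subgroup (Equiv.Perm (Fin d))}

/-! ### Hausdorff dimension of local groups -/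

section HausdorffDimension

/-- The action of `W(H)` on the level `n`. -/
def levelPerm (H : Subgroup (Equiv.Perm (Fin d))) (n : ℕ) :
    W H →* Equiv.Perm {v : Vertex d // v.length = n} where
  toFun g :=
    { toFun := fun v => ⟨g • (v : Vertex d), by rw [length_smul, v.2]⟩
      invFun := fun v => ⟨g⁻¹ • (v : Vertex d), by rw [length_smul, v.2]⟩
      left_inv := fun v => Subtype.ext (inv_smul_smul g (v : Vertex d))
      right_inv := fun v => Subtype.ext (smul_inv_smul g (v : Vertex d)) }
  map_one' := Equiv.ext fun v => Subtype.ext (one_smul _ (v : Vertex d))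
  map_mul' g h := Equiv.ext fun v => Subtype.ext (mul_smul g h (v : Vertex d))

theorem levelPerm_eq_iff {n : ℕ} {g h : W H} :
    levelPerm H n g = levelPerm H n h ↔ ∀ v : Vertex d, v.length = n → g • v = h • v := by
  constructor
  · intro hgh v hv
    exact congrArg Subtype.val (DFunLike.congr_fun hgh ⟨v, hv⟩)
  · intro hgh
    exact Equiv.ext fun v => Subtype.ext (hgh v v.2)

theorem ker_levelPerm (n : ℕ) : (levelPerm H n).ker = levelStab H n := by
  ext g
  rw [MonoidHom.mem_ker, ← map_one (levelPerm H n), levelPerm_eq_iff]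
  simp [levelStab, Subgroup.mem_iInf, MulAction.mem_stabilizer_iff]

theorem levelCard_eq (G : Subgroup (W H)) (n : ℕ) :
    levelCard G n = Nat.card (G.map (levelPerm H n)) := by
  rw [← Subgroup.relIndex_ker, ker_levelPerm]
  rfl

theorem levelCard_pos (G : Subgroup (W H)) (n : ℕ) : 0 < levelCard G n := by
  rw [levelCard_eq]
  exact Nat.card_pos

theorem levelCard_mono {G G' : Subgroup (W H)} (h : G ≤ G') (n : ℕ) :
    levelCard G n ≤ levelCard G' n := by
  rw [levelCard_eq, levelCard_eq]
  exact Subgroup.card_le_of_le (Subgroup.map_mono h)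

theorem levelCard_topologicalClosure (G : Subgroup (W H)) (n : ℕ) :
    levelCard G.topologicalClosure n = levelCard G n := by
  rw [levelCard_eq, levelCard_eq]
  congr 2
  refine le_antisymm ?_ (Subgroup.map_mono G.le_topologicalClosure)
  rintro _ ⟨g, hg, rfl⟩
  have h1 : ∀ᶠ x in 𝓝 g, ∀ v : {v : Vertex d // v.length = n},
      x • (v : Vertex d) = g • (v : Vertex d) :=
    eventually_all.2 fun v => eventually_smul_eq g v
  obtain ⟨x, hx, hxG⟩ := mem_closure_iff_nhds.1 hg _ h1
  exact ⟨x, hxG, levelPerm_eq_iff.2 fun v hv => hx ⟨v, hv⟩⟩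

theorem hdim_topologicalClosure (G : Subgroup (W H)) : hdim G.topologicalClosure = hdim G := by
  have : density G.topologicalClosure = density G := by
    funext n
    rw [density, density, levelCard_topologicalClosure]
  rw [hdim, hdim, this]

theorem levelCard_localGroup_le (G : Subgroup (W H)) (v : Vertex d) (n : ℕ) :
    levelCard (localGroup G v) n ≤ levelCard G (n + v.length) := by
  rw [levelCard_eq, levelCard_eq]
  have h (y : (localGroup G v).map (levelPerm H n)) :
      ∃ g ∈ G, g • v = v ∧ levelPerm H n (β g v) = y := by
    obtain ⟨_, _, ⟨g, hg, hgv, rfl⟩, rfl⟩ := y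
    exact ⟨g, hg, hgv, rfl⟩
  choose f hfG hfv hf using h
  refine Nat.card_le_card_of_injective (fun y =>
    (⟨_, Subgroup.mem_map_of_mem (levelPerm H (n + v.length)) (hfG y)⟩ :
      G.map (levelPerm H (n + v.length)))) ?_
  intro y z hyz
  have hyz' := levelPerm_eq_iff.1 (congrArg Subtype.val hyz)
  refine Subtype.ext ?_
  rw [← hf y, ← hf z, levelPerm_eq_iff]
  intro w hw
  have h1 := hyz' (v ++ w) (by simp [hw, add_comm])
  rw [smul_append_eq, smul_append_eq, hfv, hfv] at h1
  exact List.append_cancel_left h1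

theorem card_level (n : ℕ) : Nat.card {v : Vertex d // v.length = n} = d ^ n := by
  have h := card_vector (α := Fin d) n
  rw [Fintype.card_fin] at h
  rw [← h, ← Nat.card_eq_fintype_card]
  rfl

/-- On level `n + N` an element is determined by its action on level `N` and by the actions on level
`n` of its `d ^ N` sections. -/
theorem levelCard_top_add_le (n N : ℕ) : levelCard (⊤ : Subgroup (W H)) (n + N) ≤
    levelCard (⊤ : Subgroup (W H)) N * levelCard (⊤ : Subgroup (W H)) n ^ d ^ N := by
  rw [levelCard_eq, levelCard_eq, levelCard_eq, ← card_level N, ← Nat.card_fun, ← Nat.card_prod]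
  have h (y : (⊤ : Subgroup (W H)).map (levelPerm H (n + N))) :
      ∃ g, levelPerm H (n + N) g = y := by
    obtain ⟨_, g, _, rfl⟩ := y
    exact ⟨g, rfl⟩
  choose f hf using h
  refine Nat.card_le_card_of_injective (fun y => 
    (⟨_, Subgroup.mem_map_of_mem (levelPerm H N) (Subgroup.mem_top (f y))⟩,
      fun u => ⟨_, Subgroup.mem_map_of_mem (levelPerm H n) (Subgroup.mem_top (β (f y) u))⟩)) ?_
  intro y z hyz
  have h1 := levelPerm_eq_iff.1 (congrArg (fun p => p.1.1) hyz)
  have h2 (u : {v : Vertex d // v.length = N}) :=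
    levelPerm_eq_iff.1 (congrArg (fun p => (p.2 u).1) hyz)
  refine Subtype.ext ?_
  rw [← hf y, ← hf z, levelPerm_eq_iff]
  intro v hv
  have hN : (v.take N).length = N := by simp [hv]
  rw [← List.take_append_drop N v, smul_append_eq, smul_append_eq, h1 _ hN,
    h2 ⟨v.take N, hN⟩ (v.drop N) (by simp [hv])]

theorem levelCard_top_strictMono (hH : MulAction.IsPretransitive H (Fin d)) (hd : 2 ≤ d) :
    StrictMono (levelCard (⊤ : Subgroup (W H))) := by
  have h1 (n : ℕ) : levelCard (⊤ : Subgroup (W H)) n = (levelStab H n).index :=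
    Subgroup.relIndex_top_right _
  have h2 (n : ℕ) : (levelStab H n).FiniteIndex := by
    rw [← ker_levelPerm]
    infer_instance
  refine strictMono_nat_of_lt_succ fun n => ?_
  rw [h1, h1]
  have := h2 (n + 1)
  refine Subgroup.index_strictAnti (lt_of_le_of_ne ?_ ?_)
  · intro g hg
    simp only [levelStab, Subgroup.mem_iInf, MulAction.mem_stabilizer_iff] at hg ⊢
    intro v hv
    have h3 := congrArg (List.take n) (hg (v ++ [⟨0, by omega⟩]) (by simp [hv]))
    rwa [take_smul, ← hv, List.take_left] at h3
  · intro h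
    obtain ⟨σ, hσ⟩ := MulAction.exists_smul_eq H (⟨0, by omega⟩ : Fin d) ⟨1, by omega⟩
    have h3 : levelIns n (fun _ => rooted σ) ∈ levelStab H n := by
      simp only [levelStab, Subgroup.mem_iInf, MulAction.mem_stabilizer_iff]
      exact fun v hv => levelIns_smul_of_length _ hv.le
    rw [← h] at h3
    simp only [levelStab, Subgroup.mem_iInf, MulAction.mem_stabilizer_iff] at h3
    have h4 := h3 (List.replicate n ⟨0, by omega⟩ ++ [⟨0, by omega⟩]) (by simp)
    rw [smul_append_eq, β_levelIns _ (by simp), rooted_smul_cons,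
      levelIns_smul_of_length _ (by simp)] at h4
    have h5 := List.append_cancel_left h4
    have h6 : (σ : Equiv.Perm (Fin d)) ⟨0, by omega⟩ = ⟨1, by omega⟩ := hσ
    rw [h6] at h5
    simp at h5

theorem density_nonneg (G : Subgroup (W H)) (n : ℕ) : 0 ≤ density G n :=
  div_nonneg (Real.log_natCast_nonneg _) (Real.log_natCast_nonneg _)

theorem density_le_one (G : Subgroup (W H)) (n : ℕ) : density G n ≤ 1 := by
  refine div_le_one_of_le₀ ?_ (Real.log_natCast_nonneg _)
  refine Real.log_le_log (by exact_mod_cast levelCard_pos G n) ?_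
  exact_mod_cast levelCard_mono le_top n

/-- The Hausdorff dimension of a local group bounds the Hausdorff dimension from below. -/
theorem hdim_localGroup_div_le (hH : MulAction.IsPretransitive H (Fin d)) (hd : 2 ≤ d)
    {A G : Subgroup (W H)} (hAG : A ≤ G) (v : Vertex d) :
    hdim (localGroup A v) / (d : ℝ) ^ v.length ≤ hdim G := by
  set N := v.length with hN
  set w : ℕ → ℝ := fun n => Real.log (levelCard (⊤ : Subgroup (W H)) n) with hw
  have hdN : (0 : ℝ) < (d : ℝ) ^ N := by positivity
  have hwtop : Tendsto w atTop atTop :=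
    Real.tendsto_log_atTop.comp
      (tendsto_natCast_atTop_atTop.comp (levelCard_top_strictMono hH hd).tendsto_atTop)
  have hw0 (n : ℕ) : 0 ≤ w n := Real.log_natCast_nonneg _
  have hpos (G' : Subgroup (W H)) (n : ℕ) : (0 : ℝ) < levelCard G' n := by
    exact_mod_cast levelCard_pos G' n
  have hadd (n : ℕ) : w (n + N) ≤ w N + (d : ℝ) ^ N * w n := by
    have h1 : (levelCard (⊤ : Subgroup (W H)) (n + N) : ℝ) ≤
        levelCard (⊤ : Subgroup (W H)) N * (levelCard (⊤ : Subgroup (W H)) n : ℝ) ^ d ^ N := by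
      exact_mod_cast levelCard_top_add_le n N
    have h2 := Real.log_le_log (hpos _ _) h1
    rw [Real.log_mul (hpos _ _).ne' (pow_pos (hpos _ _) _).ne', Real.log_pow] at h2
    push_cast at h2
    exact h2
  rw [div_le_iff₀ hdN]
  refine le_of_forall_lt_imp_le_of_dense fun c hc => ?_
  rw [← div_le_iff₀ hdN]
  have hbdd (G' : Subgroup (W H)) (k : ℕ) :
      IsBoundedUnder (· ≥ ·) atTop fun n => density G' (n + k) :=
    isBoundedUnder_of ⟨0, fun n => density_nonneg G' _⟩
  -- For large `n` this sequence, which equals `c * w n / (w N + d ^ N * w n)`, bounds `density G (n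
  -- + N)` from below.
  have hlim : Tendsto (fun n => c / (w N / w n + (d : ℝ) ^ N)) atTop (𝓝 (c / (d : ℝ) ^ N)) := by
    have h1 := ((tendsto_const_nhds (x := w N)).div_atTop hwtop).add_const ((d : ℝ) ^ N)
    rw [zero_add] at h1
    exact tendsto_const_nhds.div h1 hdN.ne'
  rw [hdim, ← liminf_nat_add (density G) N, ← hlim.liminf_eq]
  refine liminf_le_liminf ?_ hlim.isBoundedUnder_ge
    (isCoboundedUnder_ge_of_le atTop (x := 1) fun n => density_le_one G _)
  filter_upwards [eventually_lt_of_lt_liminf hc (hbdd _ 0), hwtop.eventually_gt_atTop 0,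
    (hwtop.comp (tendsto_add_atTop_nat N)).eventually_gt_atTop 0] with n h1 h2 h3
  have h4 : c * w n ≤ Real.log (levelCard G (n + N)) := by
    refine ((lt_div_iff₀ h2).1 h1).le.trans (Real.log_le_log (hpos _ _) ?_)
    have h5 := levelCard_localGroup_le A v n
    have h6 := levelCard_mono hAG (n + v.length)
    exact_mod_cast h5.trans h6
  have h5 : c / (w N / w n + (d : ℝ) ^ N) = c * w n / (w N + (d : ℝ) ^ N * w n) := by
    field_simp
  rw [h5, density]
  refine (div_le_div_of_nonneg_right h4 (h3.le.trans (hadd n))).trans ?_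
  exact div_le_div_of_nonneg_left (Real.log_natCast_nonneg _) h3 (hadd n)

/-- For `d ≤ 1` the group is trivial and every density is `0 / 0 = 0`. -/
theorem two_le_of_hdim_pos {G : Subgroup (W H)} (hG : 0 < hdim G) : 2 ≤ d := by
  by_contra! hd
  have hsub : Subsingleton (Fin d) := Fin.subsingleton_iff_le_one.2 (by omega)
  have hW : ∀ g : W H, g = 1 := fun g => ext_smul fun v => by
    rw [one_smul]
    exact List.ext_getElem (length_smul g v) fun i _ _ => Subsingleton.elim _ _
  have h1 (n : ℕ) : levelCard G n = 1 := by
    rw [levelCard_eq, Nat.card_eq_one_iff_unique]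
    refine ⟨⟨?_⟩, inferInstance⟩
    rintro ⟨_, g, _, rfl⟩ ⟨_, g', _, rfl⟩
    exact Subtype.ext (congrArg (levelPerm H n) ((hW g).trans (hW g').symm))
  have h2 : density G = fun _ => 0 := by
    funext n
    rw [density, h1, Nat.cast_one, Real.log_one, zero_div]
  rw [hdim, h2, liminf_const] at hG
  exact lt_irrefl _ hG

end HausdorffDimension

end IteratedWreath

namespace IteratedWreath

open Filter Topology
open FreeGroup hiding map map_mul map_one map_inv

variable {d : ℕ} {H : Subgroup (Equiv.Perm (Fin d))} {m K : ℕ}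

/-! ### Measurable choice of the level and of the loops -/

section Choice

/-- `p` consists of a vertex of `Z` and of loops at this vertex with private edges. -/
def IsLoopSystem (Δ : Subgroup (FreeGroup (Fin m))) (a : Fin m → W H) (Z : Set (Vertex d))
    (p : Vertex d × (Fin K → FreeGroup (Fin m))) : Prop :=
  p.1 ∈ Z ∧ (∀ k, p.2 k ∈ Δ ∧ FreeGroup.lift a (p.2 k) • p.1 = p.1) ∧
    HavePrivateEdges (FreeGroup.lift a) p.1 p.2

/-- Every orbit on the level `n` has a system of `K` loops with private edges. -/
def HasLoopSystems (K : ℕ) (Δ : Subgroup (FreeGroup (Fin m))) (n : ℕ) (a : Fin m → W H) : Prop :=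
  ∀ Z ∈ levelOrbits (Δ.map (FreeGroup.lift a)) n,
    ∃ p : Vertex d × (Fin K → FreeGroup (Fin m)), IsLoopSystem Δ a Z p

theorem length_eq_of_mem_levelOrbits {G : Subgroup (W H)} {n : ℕ} {Z : Set (Vertex d)}
    (hZ : Z ∈ levelOrbits G n) {v : Vertex d} (hv : v ∈ Z) : v.length = n := by
  obtain ⟨u, hu, rfl⟩ := hZ
  obtain ⟨g, rfl⟩ := hv
  exact (length_smul (g : W H) u).trans hu

theorem isLoopSystem_iff {Δ : Subgroup (FreeGroup (Fin m))} {n : ℕ} {a a' : Fin m → W H}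
    (h : levelAction n a = levelAction n a') {Z : Set (Vertex d)}
    (hZ : Z ∈ levelOrbits (Δ.map (FreeGroup.lift a)) n)
    {p : Vertex d × (Fin K → FreeGroup (Fin m))} :
    IsLoopSystem Δ a Z p ↔ IsLoopSystem Δ a' Z p := by
  refine and_congr_right fun hp => ?_
  have hv := length_eq_of_mem_levelOrbits hZ hp
  rw [havePrivateEdges_lift_iff h hv]
  simp only [lift_smul_eq h _ hv]

theorem HasLoopSystems.of_levelAction_eq {Δ : Subgroup (FreeGroup (Fin m))} {n : ℕ}
    {a a' : Fin m → W H} (h : levelAction n a = levelAction n a') (ha : HasLoopSystems K Δ n a) :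
    HasLoopSystems K Δ n a' := by
  intro Z hZ
  have hZ' := (mem_levelOrbits_map_iff h Δ Z).2 hZ
  obtain ⟨p, hp⟩ := ha Z hZ'
  exact ⟨p, (isLoopSystem_iff h hZ').1 hp⟩

theorem hasLoopSystems_iff {Δ : Subgroup (FreeGroup (Fin m))} {n : ℕ}
    {a a' : Fin m → W H} (h : levelAction n a = levelAction n a') :
    HasLoopSystems K Δ n a ↔ HasLoopSystems K Δ n a' :=
  ⟨.of_levelAction_eq h, .of_levelAction_eq h.symm⟩

/-- The quantifier over `Δ` stands inside the almost sure event: `R` depends on `Δ` but not on the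
generators, and the levels without short loops exist for all `R` simultaneously. -/
theorem ae_forall_exists_hasLoopSystems (hH : MulAction.IsPretransitive H (Fin d)) (hd : 2 ≤ d)
    (m K : ℕ) : ∀ᵐ a ∂homMeasure H m, ∀ Δ : Subgroup (FreeGroup (Fin m)), ¬ IsCyclic Δ →
      ∃ n, HasLoopSystems K Δ n a := by
  filter_upwards [ae_forall_exists_freeUpTo hH hd m] with a ha Δ hΔ
  obtain ⟨R, hR⟩ := exists_private_loops (G := W H) (V := Vertex d) hΔ K
  obtain ⟨n, hn⟩ := ha R
  refine ⟨n, fun Z hZ => ?_⟩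
  have hfin : Z.Finite := (List.finite_length_eq (Fin d) n).subset fun v hv =>
    length_eq_of_mem_levelOrbits hZ hv
  obtain ⟨u, hu, rfl⟩ := hZ
  obtain ⟨v, hv, α, h1, h2⟩ := hR (FreeGroup.lift a) u (hn u hu) hfin
  exact ⟨(v, α), hv, h1, h2⟩

/-- The first level on which every orbit has a system of `K` loops with private edges. -/
noncomputable def loopLevel (K : ℕ) (Δ : Subgroup (FreeGroup (Fin m))) (a : Fin m → W H) : ℕ :=
  sInf {n | HasLoopSystems K Δ n a}

/-- The second alternative is the default value `sInf ∅ = 0`. For non-cyclic `Δ` it occurs on a null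
set, but it has to be accounted for in the proof of measurability. -/
theorem loopLevel_eq_iff {Δ : Subgroup (FreeGroup (Fin m))} {a : Fin m → W H} {n : ℕ} :
    loopLevel K Δ a = n ↔ (HasLoopSystems K Δ n a ∧ ∀ k < n, ¬ HasLoopSystems K Δ k a) ∨
      (n = 0 ∧ ∀ k, ¬ HasLoopSystems K Δ k a) := by
  rcases Set.eq_empty_or_nonempty {n | HasLoopSystems K Δ n a} with h | h
  · have h' : ∀ k, ¬ HasLoopSystems K Δ k a := fun k hk => (Set.eq_empty_iff_forall_notMem.1 h) k hk
    rw [loopLevel, h, Nat.sInf_empty]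
    constructor
    · rintro rfl
      exact Or.inr ⟨rfl, h'⟩
    · rintro (h1 | h1)
      · exact absurd h1.1 (h' n)
      · exact h1.1.symm
  · constructor
    · rintro rfl
      exact Or.inl ⟨Nat.sInf_mem h, fun k hk => Nat.notMem_of_lt_sInf hk⟩
    · rintro (h1 | h1)
      · refine le_antisymm (Nat.sInf_le h1.1) ?_
        by_contra! hlt
        exact h1.2 _ hlt (Nat.sInf_mem h)
      · obtain ⟨k, hk⟩ := h
        exact absurd hk (h1.2 k)

theorem measurableSet_of_levelAction {n : ℕ} {p : (Fin m → W H) → Prop}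
    (hp : ∀ a a', levelAction n a = levelAction n a' → p a → p a') : MeasurableSet {a | p a} := by
  convert measurableSet_levelAction_preimage (m := m) (levelAction n '' {a : Fin m → W H | p a})
    using 1
  ext a
  constructor
  · exact fun ha => ⟨a, ha, rfl⟩
  · rintro ⟨a', ha', h⟩
    exact hp a' a h ha'

theorem measurable_loopLevel (Δ : Subgroup (FreeGroup (Fin m))) :
    Measurable (loopLevel K Δ : (Fin m → W H) → ℕ) := by
  have h (n : ℕ) : MeasurableSet {a : Fin m → W H | HasLoopSystems K Δ n a} :=
    measurableSet_of_levelAction fun _ _ h => HasLoopSystems.of_levelAction_eq h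
  refine measurable_to_countable' fun n => ?_
  have h1 : loopLevel K Δ ⁻¹' {n} = {a : Fin m → W H | (HasLoopSystems K Δ n a ∧
      ∀ k, k < n → ¬ HasLoopSystems K Δ k a) ∨ (n = 0 ∧ ∀ k, ¬ HasLoopSystems K Δ k a)} := by
    ext a
    exact loopLevel_eq_iff
  rw [h1]
  have h2 : MeasurableSet {a : Fin m → W H | ∀ k, ¬ HasLoopSystems K Δ k a} := by
    have : {a : Fin m → W H | ∀ k, ¬ HasLoopSystems K Δ k a} =
        ⋂ k, {a | HasLoopSystems K Δ k a}ᶜ := by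
      ext a
      simp
    rw [this]
    exact MeasurableSet.iInter fun k => (h k).compl
  have h3 : MeasurableSet {a : Fin m → W H | ∀ k, k < n → ¬ HasLoopSystems K Δ k a} :=
    measurableSet_of_levelAction fun a a' haa' ha k hk hk' =>
      ha k hk ((hasLoopSystems_iff (levelAction_eq_of_le hk.le haa')).2 hk')
  exact ((h n).inter h3).union ((MeasurableSet.const _).inter h2)

/-- There are only finitely many actions on each level, so every preimage, even for the discrete
σ-algebra on `X`, is a countable union of measurable sets. -/
theorem measurable_of_levelAction {X : Type*} {N : (Fin m → W H) → ℕ} (hN : Measurable N)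
    {f : (Fin m → W H) → X}
    (hf : ∀ a a', N a = N a' → levelAction (N a) a = levelAction (N a) a' → f a = f a') :
    Measurable[_, ⊤] f := by
  intro S _
  have h1 : f ⁻¹' S = ⋃ n, {a | N a = n} ∩
      {a | ∃ a', N a' = n ∧ levelAction n a' = levelAction n a ∧ f a' ∈ S} := by
    ext a
    simp only [Set.mem_preimage, Set.mem_iUnion, Set.mem_inter_iff, Set.mem_ofPred_eq]
    constructor
    · exact fun ha => ⟨N a, rfl, a, rfl, rfl, ha⟩
    · rintro ⟨n, rfl, a', h1, h2, h3⟩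
      rwa [← hf a' a h1 (h1 ▸ h2)]
  rw [h1]
  refine MeasurableSet.iUnion fun n => (hN (measurableSet_singleton n)).inter ?_
  refine measurableSet_of_levelAction (n := n) ?_
  rintro a a' h ⟨b, hb, hb', hb''⟩
  exact ⟨b, hb, hb'.trans h, hb''⟩

/-- Generators with the same action on the level `n` that depend only on this action. -/
noncomputable def levelRep (n : ℕ) (a : Fin m → W H) : Fin m → W H :=
  Function.invFun (levelAction n) (levelAction n a)

theorem levelAction_levelRep (n : ℕ) (a : Fin m → W H) :
    levelAction n (levelRep n a) = levelAction n a :=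
  Function.invFun_eq ⟨a, rfl⟩

/-- A system of `K` loops at a vertex of `Z`, if there is one, that depends only on the level
`loopLevel K Δ a` and on the action on this level. -/
noncomputable def loopSystem (K : ℕ) (Δ : Subgroup (FreeGroup (Fin m))) (a : Fin m → W H)
    (Z : Set (Vertex d)) : Vertex d × (Fin K → FreeGroup (Fin m)) :=
  Classical.epsilon (IsLoopSystem Δ (levelRep (loopLevel K Δ a) a) Z)

theorem loopSystem_eq {Δ : Subgroup (FreeGroup (Fin m))} {a a' : Fin m → W H}
    (h : loopLevel K Δ a = loopLevel K Δ a')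
    (h' : levelAction (loopLevel K Δ a) a = levelAction (loopLevel K Δ a) a')
    (Z : Set (Vertex d)) : loopSystem K Δ a Z = loopSystem K Δ a' Z := by
  rw [loopSystem, loopSystem, ← h, levelRep, levelRep, h']

theorem isLoopSystem_loopSystem {Δ : Subgroup (FreeGroup (Fin m))} {a : Fin m → W H}
    (ha : HasLoopSystems K Δ (loopLevel K Δ a) a) {Z : Set (Vertex d)}
    (hZ : Z ∈ levelOrbits (Δ.map (FreeGroup.lift a)) (loopLevel K Δ a)) :
    IsLoopSystem Δ a Z (loopSystem K Δ a Z) := by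
  obtain ⟨p, hp⟩ := ha Z hZ
  have h := (levelAction_levelRep (loopLevel K Δ a) a).symm
  exact (isLoopSystem_iff h hZ).2 (Classical.epsilon_spec ⟨p, (isLoopSystem_iff h hZ).1 hp⟩)

theorem measurable_loopSystem {X : Type*} (Δ : Subgroup (FreeGroup (Fin m))) (Z : Set (Vertex d))
    (f : Vertex d × (Fin K → FreeGroup (Fin m)) → X) :
    Measurable[_, ⊤] fun a : Fin m → W H => f (loopSystem K Δ a Z) :=
  measurable_of_levelAction (measurable_loopLevel (K := K) Δ) fun _ _ h h' =>
    congrArg f (loopSystem_eq h h' Z)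

end Choice

/-! ### Conditional law of the sections of the chosen loops -/

section Law

theorem measurable_β_loopSystem (Δ : Subgroup (FreeGroup (Fin m))) (Z : Set (Vertex d)) :
    Measurable fun (a : Fin m → W H) k =>
      β (FreeGroup.lift a ((loopSystem K Δ a Z).2 k)) (loopSystem K Δ a Z).1 := by
  intro B hB
  have h1 : (fun (a : Fin m → W H) k =>
      β (FreeGroup.lift a ((loopSystem K Δ a Z).2 k)) (loopSystem K Δ a Z).1) ⁻¹' B =
      ⋃ p : Vertex d × (Fin K → FreeGroup (Fin m)), {a | loopSystem K Δ a Z = p} ∩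
        {a | (fun k => β (FreeGroup.lift a (p.2 k)) p.1) ∈ B} := by
    ext a
    simp
  rw [h1]
  have : Countable (FreeGroup (Fin m)) := inferInstance
  refine MeasurableSet.iUnion fun p => ?_
  exact (measurable_loopSystem Δ Z id (MeasurableSpace.measurableSet_top (s := {p}))).inter
    (measurable_β_lift p.1 p.2 hB)

/-- Split according to the action on level `n`. On a cell that meets the event and has loop systems,
the chosen loops are constant and have private edges, so `measure_levelAction_inter_preimage`
applies cell by cell. -/
theorem map_cond_β_loopSystem (hH : MulAction.IsPretransitive H (Fin d)) (hd : 2 ≤ d)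
    {Δ : Subgroup (FreeGroup (Fin m))} (hΔ : ¬ IsCyclic Δ) (Z : Set (Vertex d)) (n : ℕ)
    (h0 : homMeasure H m {a | loopLevel K Δ a = n ∧
      Z ∈ levelOrbits (Δ.map (FreeGroup.lift a)) n} ≠ 0) :
    Measure.map (fun a k => β (FreeGroup.lift a ((loopSystem K Δ a Z).2 k)) (loopSystem K Δ a Z).1)
      (ProbabilityTheory.cond (homMeasure H m)
        {a | loopLevel K Δ a = n ∧ Z ∈ levelOrbits (Δ.map (FreeGroup.lift a)) n}) =
      homMeasure H K := by
  set E : Set (Fin m → W H) :=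
    {a | loopLevel K Δ a = n ∧ Z ∈ levelOrbits (Δ.map (FreeGroup.lift a)) n} with hE
  set f : (Fin m → W H) → Fin K → W H :=
    fun a k => β (FreeGroup.lift a ((loopSystem K Δ a Z).2 k)) (loopSystem K Δ a Z).1 with hf
  have hfm : Measurable f := measurable_β_loopSystem Δ Z
  have hEm : MeasurableSet E := (measurable_loopLevel Δ (measurableSet_singleton n)).inter
    (measurableSet_of_levelAction fun a a' h => (mem_levelOrbits_map_iff h Δ Z).1)
  have hsum (S : Set (Fin m → W H)) : homMeasure H m S =
      ∑' σ, homMeasure H m (S ∩ {a | levelAction n a = σ}) := by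
    have hm (σ : Fin m → {v : Vertex d // v.length = n} → {v : Vertex d // v.length = n}) :
        MeasurableSet (levelAction n ⁻¹' {σ} : Set (Fin m → W H)) :=
      measurableSet_levelAction_preimage {σ}
    have h1 := tsum_measure_preimage_singleton (μ := (homMeasure H m).restrict S)
      Set.countable_univ fun σ _ => hm σ
    rw [Set.preimage_univ, Measure.restrict_apply_univ, tsum_univ
      fun σ => (homMeasure H m).restrict S (levelAction n ⁻¹' {σ})] at h1
    rw [← h1]
    refine tsum_congr fun σ => ?_
    rw [Measure.restrict_apply (hm σ), Set.inter_comm]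
    rfl
  refine Measure.ext fun B hB => ?_
  rw [Measure.map_apply hfm hB, ProbabilityTheory.cond_apply hEm]
  suffices h : homMeasure H m (E ∩ f ⁻¹' B) = homMeasure H m E * homMeasure H K B by
    rw [h, ← mul_assoc, ENNReal.inv_mul_cancel h0 (measure_ne_top _ _), one_mul]
  rw [hsum, hsum E, ← ENNReal.tsum_mul_right]
  refine tsum_congr fun σ => ?_
  by_cases hσ : ∃ a₀ ∈ E, levelAction n a₀ = σ
  · obtain ⟨a₀, ha₀, rfl⟩ := hσ
    by_cases hg : HasLoopSystems K Δ n a₀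
    · have hCE : ∀ a, levelAction n a = levelAction n a₀ → a ∈ E := by
        intro a ha
        refine ⟨loopLevel_eq_iff.2 (Or.inl ⟨(hasLoopSystems_iff ha).2 hg, fun k hk h => ?_⟩),
          (mem_levelOrbits_map_iff ha Δ Z).2 ha₀.2⟩
        refine Nat.notMem_of_lt_sInf (ha₀.1 ▸ hk : k < loopLevel K Δ a₀) ?_
        exact (hasLoopSystems_iff (levelAction_eq_of_le hk.le ha)).1 h
      have hp := isLoopSystem_loopSystem (a := a₀) (Z := Z) (by rw [ha₀.1]; exact hg)
        (by rw [ha₀.1]; exact ha₀.2)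
      have h1 : E ∩ {a | levelAction n a = levelAction n a₀} =
          {a | levelAction n a = levelAction n a₀} :=
        Set.inter_eq_right.2 hCE
      rw [h1, ← measure_levelAction_inter_preimage
        (length_eq_of_mem_levelOrbits ha₀.2 hp.1) hp.2.2 hB]
      congr 1
      ext a
      have h2 (ha : levelAction n a = levelAction n a₀) :
          loopSystem K Δ a Z = loopSystem K Δ a₀ Z := by
        have h3 := (hCE a ha).1
        exact loopSystem_eq (h3.trans ha₀.1.symm) (h3.symm ▸ ha) Z
      constructor
      · rintro ⟨⟨_, h3⟩, ha⟩
        refine ⟨ha, ?_⟩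
        simpa only [hf, Set.mem_preimage, h2 ha] using h3
      · rintro ⟨ha, h3⟩
        refine ⟨⟨hCE a ha, ?_⟩, ha⟩
        simpa only [hf, Set.mem_preimage, h2 ha] using h3
    -- Here `loopLevel` equals `n` only through its default value, which almost surely does not
    -- happen.
    · have h1 : homMeasure H m (E ∩ {a | levelAction n a = levelAction n a₀}) = 0 := by
        refine measure_mono_null ?_ (ae_iff.1 (ae_forall_exists_hasLoopSystems hH hd m K))
        rintro a ⟨ha, ha'⟩ h
        obtain ⟨k, hk⟩ := h Δ hΔ
        rcases loopLevel_eq_iff.1 ha.1 with h2 | h2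
        · exact hg ((hasLoopSystems_iff ha').1 h2.1)
        · exact h2.2 k hk
      rw [h1, zero_mul]
      exact measure_mono_null (by gcongr; exact Set.inter_subset_left) h1
  · push Not at hσ
    have h1 : E ∩ {a | levelAction n a = σ} = ∅ :=
      Set.eq_empty_of_forall_notMem fun a ha => hσ a ha.1 ha.2
    have h2 : E ∩ f ⁻¹' B ∩ {a | levelAction n a = σ} = ∅ :=
      Set.eq_empty_of_forall_notMem fun a ha => hσ a ha.1.1 ha.2
    rw [h1, h2, measure_empty, zero_mul]

/-- All generators fix `v`, so the whole group does and `β · v` is multiplicative on it. This brings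
the local group into the form in which the hypothesis on random `K`-generated groups applies. -/
theorem localGroup_map_closure_range {ι : Type*} (φ : FreeGroup ι →* W H) (v : Vertex d)
    (α : Fin K → FreeGroup ι) (hα : ∀ k, φ (α k) • v = v) :
    localGroup ((Subgroup.closure (Set.range α)).map φ) v =
      (FreeGroup.lift fun k => β (φ (α k)) v).range := by
  refine le_antisymm ?_ ?_
  · rintro _ ⟨_, ⟨y, hy, rfl⟩, -, rfl⟩
    refine (Subgroup.closure_induction (p := fun y _ => φ y • v = v ∧
      β (φ y) v ∈ (FreeGroup.lift fun k => β (φ (α k)) v).range) ?_ ?_ ?_ ?_ hy).2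
    · rintro _ ⟨k, rfl⟩
      exact ⟨hα k, FreeGroup.of k, by simp⟩
    · rw [map_one, β_one]
      exact ⟨one_smul _ _, one_mem _⟩
    · rintro x y - - ⟨hx, hx'⟩ ⟨hy, hy'⟩
      rw [map_mul, mul_smul, hy, hx, β_mul, hy]
      exact ⟨rfl, mul_mem hx' hy'⟩
    · rintro x - ⟨hx, hx'⟩
      have h : (φ x)⁻¹ • v = v := inv_smul_eq_iff.2 hx.symm
      rw [map_inv, β_inv, h]
      exact ⟨rfl, inv_mem hx'⟩
  · rw [FreeGroup.range_lift_eq_closure, Subgroup.closure_le]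
    rintro _ ⟨k, rfl⟩
    exact ⟨φ (α k), ⟨α k, Subgroup.subset_closure ⟨k, rfl⟩, rfl⟩, hα k, rfl⟩

end Law

end IteratedWreath

theorem corollary3p4 {d : ℕ} (H : Subgroup (Equiv.Perm (Fin d)))
    (hH : MulAction.IsPretransitive H (Fin d)) (K : ℕ)
    (hK : ∀ᵐ a ∂(homMeasure H K), 0 < hdim (FreeGroup.lift a).range.topologicalClosure)
    (m : ℕ) (hm : 2 ≤ m) :
    -- almost surely, every non-cyclic subgroup has positive Hausdorff dimension
    (∀ᵐ a ∂(homMeasure H m), ∀ Δ : Subgroup (FreeGroup (Fin m)), ¬ IsCyclic Δ →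
      0 < hdim (Δ.map (FreeGroup.lift a))) ∧
    -- the lower bound: the random level `N`, and for each orbit `Z` of `Δ` on that level the random
    -- vertex `v` and the random elements `α 1, …, α K`
    ∃ (N : Subgroup (FreeGroup (Fin m)) → (Fin m → W H) → ℕ)
      (v : Subgroup (FreeGroup (Fin m)) → (Fin m → W H) → Set (Vertex d) → Vertex d)
      (α : Subgroup (FreeGroup (Fin m)) → (Fin m → W H) → Set (Vertex d) →
        Fin K → FreeGroup (Fin m)),
      (∀ Δ : Subgroup (FreeGroup (Fin m)), ¬ IsCyclic Δ →
        Measurable (N Δ) ∧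
        ∀ Z : Set (Vertex d),
          Measurable[_, ⊤] (fun a => v Δ a Z) ∧
          (∀ k, Measurable[_, ⊤] (fun a => α Δ a Z k)) ∧
          -- given that `N = n` and that `Z` is an orbit of `Δ` on the `n`-th level, the elements
          -- `β(α k, v)` are `K` independent Haar-random elements of `W(H)`
          ∀ n : ℕ,
            homMeasure H m {a | N Δ a = n ∧ Z ∈ levelOrbits (Δ.map (FreeGroup.lift a)) n} ≠ 0 →
            Measure.map (fun a k => β (FreeGroup.lift a (α Δ a Z k)) (v Δ a Z))
              (ProbabilityTheory.cond (homMeasure H m)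
                {a | N Δ a = n ∧ Z ∈ levelOrbits (Δ.map (FreeGroup.lift a)) n}) =
              homMeasure H K) ∧
      ∀ᵐ a ∂(homMeasure H m), ∀ Δ : Subgroup (FreeGroup (Fin m)), ¬ IsCyclic Δ →
        ∀ Z ∈ levelOrbits (Δ.map (FreeGroup.lift a)) (N Δ a),
          v Δ a Z ∈ Z ∧
          (∀ k, α Δ a Z k ∈ Δ ∧ FreeGroup.lift a (α Δ a Z k) • v Δ a Z = v Δ a Z) ∧
          0 < hdim (localGroup
            ((Subgroup.closure (Set.range (α Δ a Z))).map (FreeGroup.lift a)) (v Δ a Z)) ∧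
          hdim (localGroup
            ((Subgroup.closure (Set.range (α Δ a Z))).map (FreeGroup.lift a)) (v Δ a Z)) /
              (d : ℝ) ^ N Δ a ≤ hdim (Δ.map (FreeGroup.lift a)) := by
  have hd : 2 ≤ d := by
    obtain ⟨_, h⟩ := hK.exists
    exact two_le_of_hdim_pos h
  have hmain : ∀ᵐ a ∂(homMeasure H m), ∀ Δ : Subgroup (FreeGroup (Fin m)), ¬ IsCyclic Δ →
      ∀ Z ∈ levelOrbits (Δ.map (FreeGroup.lift a)) (loopLevel K Δ a),
        (loopSystem K Δ a Z).1 ∈ Z ∧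
        (∀ k, (loopSystem K Δ a Z).2 k ∈ Δ ∧
          FreeGroup.lift a ((loopSystem K Δ a Z).2 k) • (loopSystem K Δ a Z).1 =
            (loopSystem K Δ a Z).1) ∧
        0 < hdim (localGroup ((Subgroup.closure (Set.range (loopSystem K Δ a Z).2)).map
          (FreeGroup.lift a)) (loopSystem K Δ a Z).1) ∧
        hdim (localGroup ((Subgroup.closure (Set.range (loopSystem K Δ a Z).2)).map
          (FreeGroup.lift a)) (loopSystem K Δ a Z).1) / (d : ℝ) ^ loopLevel K Δ a ≤
            hdim (Δ.map (FreeGroup.lift a)) := by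
    -- There are only countably many pairs `(v, α)`, so the hypothesis `hK` can be transferred to
    -- all of them on one almost sure event, before the random choice is substituted.
    filter_upwards [ae_forall_exists_hasLoopSystems hH hd m K,
      ae_all_iff.2 fun v => ae_all_iff.2 fun α => ae_of_havePrivateEdges (m := m) hK v α]
      with a h1 h2 Δ hΔ Z hZ
    have hp := isLoopSystem_loopSystem (Nat.sInf_mem (h1 Δ hΔ)) hZ
    have hlen := length_eq_of_mem_levelOrbits hZ hp.1
    refine ⟨hp.1, hp.2.1, ?_, ?_⟩
    · rw [localGroup_map_closure_range _ _ _ fun k => (hp.2.1 k).2, ← hdim_topologicalClosure]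
      exact h2 _ _ hp.2.2
    · rw [← hlen]
      refine hdim_localGroup_div_le hH hd (Subgroup.map_mono ?_) _
      rw [Subgroup.closure_le]
      rintro _ ⟨k, rfl⟩
      exact (hp.2.1 k).1
  refine ⟨?_, loopLevel K, fun Δ a Z => (loopSystem K Δ a Z).1,
    fun Δ a Z => (loopSystem K Δ a Z).2, fun Δ hΔ => ⟨measurable_loopLevel Δ, fun Z =>
      ⟨measurable_loopSystem Δ Z Prod.fst, fun k => measurable_loopSystem Δ Z fun p => p.2 k,
        map_cond_β_loopSystem hH hd hΔ Z⟩⟩, hmain⟩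
  filter_upwards [hmain] with a ha Δ hΔ
  -- Any orbit on the level will do; that of the vertex `0…0` is taken.
  obtain ⟨-, -, h1, h2⟩ := ha Δ hΔ _
    ⟨List.replicate (loopLevel K Δ a) ⟨0, by omega⟩, List.length_replicate, rfl⟩
  exact (div_pos h1 (by positivity)).trans_le h2
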